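/- Let $\mathcal S$ be a finite set of $S\ge 1$ states, $Q$ a row stochastic $\mathcal S\times\mathcal S$ matrix, $c\in\mathbb R_+^{\mathcal S}$ a cost vector, $\alpha\in(0,1)$, and $v=(1-\alpha)\sum_{t\ge 0}\alpha^tQ^tc$ the value function. Let $A\in\{0,1\}^{\mathcal S\times\mathcal S}$ satisfy $A(s,s')=0\Rightarrow Q(s,s')=0$, put $N_{in}(s)=\{s':A(s',s)=1\}$, and let $\epsilon>0$ and integers $n_B\ge 1$, $n_F\ge 0$ be given. *Backward-EPE.* Start with $\hat v_0=0$, $r_0=c$, $U_0=\emptyset$, $\hat Q_0=0$, $k=0$. While $\|r_k\|_\infty>\epsilon$: increase $k$ by one; choose $s_k$ uniformly at random among the maximizers of $r_{k-1}$; set $U_k=U_{k-1}\cup N_{in}(s_k)$; for each $s\in N_{in}(s_k)\setminus U_{k-1}$ draw fresh independent samples $X_{s,1},\dots,X_{s,n_B}\sim Q(s,\cdot)$ and let $\hat Q_k(s,\cdot)$ be their empirical distribution, and for all other $s$ set $\hat Q_k(s,\cdot)=\hat Q_{k-1}(s,\cdot)$; finally set $\hat v_k(s_k)=\hat v_{k-1}(s_k)+(1-\alpha)r_{k-1}(s_k)$,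 $r_k(s_k)=\alpha\hat Q_k(s_k,s_k)r_{k-1}(s_k)$, and, for $s\ne s_k$, $\hat v_k(s)=\hat v_{k-1}(s)$, $r_k(s)=r_{k-1}(s)+\alpha\hat Q_k(s,s_k)r_{k-1}(s_k)$. Let $k_*$ be the iteration at which this terminates. *Bidirectional-EPE.* After Backward-EPE has terminated, let $\underline Q(s,\cdot)=\hat Q_{k_*}(s,\cdot)$ for $s\in U_{k_*}$ and $\underline Q(s,\cdot)=Q(s,\cdot)$ for $s\notin U_{k_*}$, and let $\underline{\mu_s}=(1-\alpha)e_s^{\mathsf T}(I-\alpha\underline Q)^{-1}$ (the law of the end point of a trajectory on $\underline Q$ started at $s$ whose length $L$ has $\mathbb P(L=t)=(1-\alpha)\alpha^t$). For each $s$ draw independent samples $Z_{s,1},\dots,Z_{s,n_F}\sim\underline{\mu_s}$ and output $\hat v_{BD}(s)=\hat v_{k_*}(s)+\frac1{n_F}\sum_{i=1}^{n_F}r_{k_*}(Z_{s,i})$ (with the last term read as $0$ if $n_F=0$). **Theorem.** Fix $\epsilon_{rel}\in(0,1)$ and $\epsilon_{abs},\delta>0$, and define $$n_F^*=\frac{324\,\epsilon\log(4S/\delta)}{\epsilon_{rel}^2\,\epsilon_{abs}},\qquad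 n_B^*=\frac{3\log(4S^2/\delta)}{(\log(1+\epsilon_{rel}/2))^2\,\min_{i,j\in\mathcal S:\,Q(i,j)>0}Q(i,j)}\left\lceil\frac{\log(2\|c\|_\infty/\epsilon_{abs})}{1-\alpha}\right\rceil^2$$ (with the last factor read as $0$ if $c=0$). If $n_F\ge n_F^*$ and $n_B\ge n_B^*$, then $$\mathbb P\Big(\bigcup_{s\in\mathcal S}\{|\hat v_{BD}(s)-v(s)|>\epsilon_{rel}v(s)+\epsilon_{abs}\}\Big)\le\delta,$$ where a run that does not terminate is counted as a failure. That is, with probability at least $1-\delta$, every state $s$ satisfies $|\hat v_{BD}(s)-v(s)|\le\epsilon_{rel}v(s)+\epsilon_{abs}$. -/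

import Mathlib

open scoped ENNReal

noncomputable section

namespace EPE

/-! ### Randomised programs as probability mass functions -/

section Programs

variable {ι β σ : Type*}

/-- The joint law of independent random variables indexed by a finite type `ι`, the `i`-th of
which has law `p i`. -/
def indepPMF [Fintype ι] [DecidableEq ι] [Fintype β] (p : ι → PMF β) : PMF (ι → β) :=
  PMF.ofFintype (fun z => ∏ i, p i (z i)) (by
    rw [← Fintype.prod_sum (fun i b => p i b)]
    refine Finset.prod_eq_one fun i _ => ?_
    exact (tsum_fintype (fun b => p i b)).symm.trans (p i).tsum_coe)

/-- The empirical distribution of a list of `n ≥ 1` samples. -/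
def empirical {n : ℕ} [NeZero n] (x : Fin n → β) : PMF β :=
  (PMF.uniformOfFintype (Fin n)).map x

theorem empirical_apply [DecidableEq β] {n : ℕ} [NeZero n] (x : Fin n → β) (b : β) :
    (empirical x b).toReal = 1 / (n : ℝ) * ∑ i, if x i = b then 1 else 0 := by
  rw [empirical, PMF.map_apply, tsum_fintype, ENNReal.toReal_sum, Finset.mul_sum]
  · refine Finset.sum_congr rfl fun i _ => ?_
    by_cases h : x i = b
    · simp [h]
    · simp [h, Ne.symm h]
  · intro i _
    split_ifs
    · exact PMF.apply_ne_top _ _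
    · exact ENNReal.zero_ne_top

/-- The state of the randomised loop "while not `halt`, do `body`", started in `x`, after the loop
has been given (at most) `n` rounds. -/
def loopIter (halt : σ → Prop) [DecidablePred halt] (body : σ → PMF σ) : ℕ → σ → PMF σ
  | 0, x => PMF.pure x
  | n + 1, x => if halt x then PMF.pure x else (body x).bind (loopIter halt body n)

theorem loopIter_le_succ (halt : σ → Prop) [DecidablePred halt] (body : σ → PMF σ) {y : σ}
    (hy : halt y) (n : ℕ) (x : σ) :
    loopIter halt body n x y ≤ loopIter halt body (n + 1) x y := by
  induction n generalizing x with
  | zero =>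
    by_cases hx : halt x
    · simp [loopIter, hx]
    · have hxy : y ≠ x := fun h => hx (h ▸ hy)
      simp [loopIter, PMF.pure_apply, hxy]
  | succ n ih =>
    rw [loopIter, loopIter]
    by_cases hx : halt x
    · simp [hx]
    · simp only [hx, if_false, PMF.bind_apply]
      exact ENNReal.tsum_le_tsum fun z => mul_le_mul_right (ih z) _

/-- The probability that the loop halts, and does so in the state `y`. -/
def haltWeight (halt : σ → Prop) [DecidablePred halt] (body : σ → PMF σ) (x y : σ) : ℝ≥0∞ :=
  ⨆ n, if halt y then loopIter halt body n x y else 0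

theorem tsum_haltWeight_le_one (halt : σ → Prop) [DecidablePred halt] (body : σ → PMF σ) (x : σ) :
    ∑' y, haltWeight halt body x y ≤ 1 := by
  rw [ENNReal.tsum_eq_iSup_sum]
  refine iSup_le fun F => ?_
  unfold haltWeight
  rw [ENNReal.finsetSum_iSup_of_monotone]
  · refine iSup_le fun n => ?_
    calc ∑ y ∈ F, (if halt y then loopIter halt body n x y else 0)
        ≤ ∑ y ∈ F, loopIter halt body n x y :=
          Finset.sum_le_sum fun y _ => by split_ifs <;> simp
      _ ≤ ∑' y, loopIter halt body n x y := ENNReal.sum_le_tsum F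
      _ = 1 := (loopIter halt body n x).tsum_coe
  · intro y
    refine monotone_nat_of_le_succ fun n => ?_
    by_cases hy : halt y
    · simpa [hy] using loopIter_le_succ halt body hy n x
    · simp [hy]

theorem tsum_option_elim (a : ℝ≥0∞) (g : σ → ℝ≥0∞) :
    ∑' o : Option σ, o.elim a g = a + ∑' y, g y := by
  rw [← (Equiv.optionEquivSumPUnit.{0} σ).symm.tsum_eq,
    Summable.tsum_sum ENNReal.summable ENNReal.summable, add_comm]
  simp

/-- The outcome of the randomised loop "while not `halt`, do `body`", started in `x`: `some y` if
the loop halts in the state `y`, and `none` if it runs forever. -/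
def whileLoop (halt : σ → Prop) [DecidablePred halt] (body : σ → PMF σ) (x : σ) :
    PMF (Option σ) :=
  ⟨fun o => o.elim (1 - ∑' y, haltWeight halt body x y) (haltWeight halt body x), by
    rw [ENNReal.summable.hasSum_iff, tsum_option_elim]
    exact tsub_add_cancel_of_le (tsum_haltWeight_le_one halt body x)⟩

end Programs

/-! ### The model -/

variable {𝒮 : Type*} [Fintype 𝒮] [DecidableEq 𝒮]

/-- The value function `v = (1 - α) ∑ₜ αᵗ Qᵗ c`. -/
def valueFn (Q : Matrix 𝒮 𝒮 ℝ) (c : 𝒮 → ℝ) (α : ℝ) (s : 𝒮) : ℝ :=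
  (1 - α) * ∑' t : ℕ, α ^ t * (Q ^ t).mulVec c s

/-- The sampler of a row stochastic matrix `Q`: at a state `s` it returns a random state with
distribution `Q(s, ·)`. -/
def sampler (Q : Matrix 𝒮 𝒮 ℝ) (hQ : Q ∈ Matrix.rowStochastic ℝ 𝒮) (s : 𝒮) : PMF 𝒮 :=
  PMF.ofFintype (fun s' => ENNReal.ofReal (Q s s')) (by
    rw [← ENNReal.ofReal_sum_of_nonneg fun s' _ => Matrix.nonneg_of_mem_rowStochastic hQ,
      Matrix.sum_row_of_mem_rowStochastic hQ, ENNReal.ofReal_one])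

/-- The incoming neighbours of `s` in the supergraph with adjacency matrix `A`. -/
def inNbrs (A : 𝒮 → 𝒮 → Bool) (s : 𝒮) : Finset 𝒮 :=
  Finset.univ.filter fun s' => A s' s = true

/-! ### Backward-EPE -/

/-- The variables of Backward-EPE: the estimate `v̂` of the value function, the residual vector
`r`, and the estimated rows of the transition matrix. The row of `s` is `none` until `s` is
encountered; it is then `some` empirical distribution. -/
structure State (𝒮 : Type*) where
  /-- the estimate `v̂` -/
  val : 𝒮 → ℝ
  /-- the residual vector `r` -/
  res : 𝒮 → ℝ
  /-- the estimated rows of the transition matrix -/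
  row : 𝒮 → Option (PMF 𝒮)

/-- The encountered set `U`. -/
def State.enc (x : State 𝒮) : Finset 𝒮 := Finset.univ.filter fun s => (x.row s).isSome

/-- The entries of the estimate `Q̂` of the transition matrix; rows of states that have not been
encountered are zero. -/
def State.Qhat (x : State 𝒮) (s s' : 𝒮) : ℝ := (x.row s).elim 0 fun p => (p s').toReal

/-- The initial values `v̂ = 0`, `r = c`, `U = ∅`, `Q̂ = 0`. -/
def State.init (c : 𝒮 → ℝ) : State 𝒮 := ⟨0, c, fun _ => none⟩

/-- The maximisers of a vector. -/
def argmax {𝒮 : Type*} [Fintype 𝒮] (r : 𝒮 → ℝ) : Finset 𝒮 := by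
  classical exact Finset.univ.filter fun s => ∀ s', r s' ≤ r s

theorem argmax_nonempty {𝒮 : Type*} [Fintype 𝒮] [Nonempty 𝒮] (r : 𝒮 → ℝ) : (argmax r).Nonempty := by
  obtain ⟨s, hs⟩ := Finite.exists_max r
  exact ⟨s, by simpa [argmax] using hs⟩

/-- Record the empirical distributions of the samples `X` as the rows of the states in `T`. -/
def State.record {n : ℕ} [NeZero n] (x : State 𝒮) (T : Finset 𝒮) (X : T × Fin n → 𝒮) :
    State 𝒮 :=
  { x with row := fun s => if h : s ∈ T then some (empirical fun i => X (⟨s, h⟩, i))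
                           else x.row s }

/-- Push the residual at `sk`, with the current (already updated) estimate `Q̂`. -/
def State.push (x : State 𝒮) (α : ℝ) (sk : 𝒮) : State 𝒮 :=
  { x with
    val := fun s => if s = sk then x.val s + (1 - α) * x.res s else x.val s
    res := fun s => if s = sk then α * x.Qhat s sk * x.res sk
                    else x.res s + α * x.Qhat s sk * x.res sk }

/-- One round of Backward-EPE: choose `sk` uniformly among the maximisers of the residual, draw
`n` independent samples from `P s` for each in-neighbour `s` of `sk` that has not been encountered
before, record their empirical distributions, and push the residual at `sk`. -/
def backwardStep [Nonempty 𝒮] (P : 𝒮 → PMF 𝒮) (α : ℝ) (A : 𝒮 → 𝒮 → Bool) (n : ℕ) [NeZero n]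
    (x : State 𝒮) : PMF (State 𝒮) :=
  (PMF.uniformOfFinset (argmax x.res) (argmax_nonempty x.res)).bind fun sk =>
    (indepPMF fun si : ↥(inNbrs A sk \ x.enc) × Fin n => P si.1).map fun X =>
      (x.record _ X).push α sk

open Classical in
/-- Backward-EPE with sampler `P`, cost vector `c`, discount factor `α`, supergraph `A`,
termination parameter `ε` and per-state sample count `n`: run `backwardStep` as long as the
sup-norm of the residual exceeds `ε`. The outcome is `none` if this never ends. -/
def backwardEPE [Nonempty 𝒮] (P : 𝒮 → PMF 𝒮) (c : 𝒮 → ℝ) (α : ℝ) (A : 𝒮 → 𝒮 → Bool) (ε : ℝ)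
    (n : ℕ) [NeZero n] : PMF (Option (State 𝒮)) :=
  whileLoop (fun x => ‖x.res‖ ≤ ε) (backwardStep P α A n) (State.init c)

/-! ### Bidirectional-EPE -/

/-- The rows of the matrix that has the estimated row at each encountered state and the true
row at every other state. -/
def State.mixedRow (x : State 𝒮) (P : 𝒮 → PMF 𝒮) (s : 𝒮) : PMF 𝒮 := (x.row s).getD (P s)

/-- The geometric distribution on `{0, 1, 2, …}` with weights `(1 - α) αᵗ`. -/
def walkLength (α : ℝ) (hα : α ∈ Set.Ioo (0 : ℝ) 1) : PMF ℕ :=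
  ⟨fun t => ENNReal.ofReal ((1 - α) * α ^ t), by
    have h := (hasSum_geometric_of_lt_one hα.1.le hα.2).mul_left (1 - α)
    rw [mul_inv_cancel₀ (sub_pos.2 hα.2).ne'] at h
    have hnn : ∀ t : ℕ, 0 ≤ (1 - α) * α ^ t := fun t =>
      mul_nonneg (sub_pos.2 hα.2).le (pow_nonneg hα.1.le t)
    rw [ENNReal.summable.hasSum_iff, ← ENNReal.ofReal_tsum_of_nonneg hnn h.summable, h.tsum_eq,
      ENNReal.ofReal_one]⟩

/-- The law of the state after `t` steps of the Markov chain with transition rows `R`, started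
in `s`. -/
def walk (R : 𝒮 → PMF 𝒮) : ℕ → 𝒮 → PMF 𝒮
  | 0, s => PMF.pure s
  | t + 1, s => (walk R t s).bind R

/-- The law of the end of a trajectory of geometric length of the Markov chain with transition
rows `R`, started in `s`. -/
def discountedLaw (R : 𝒮 → PMF 𝒮) (α : ℝ) (hα : α ∈ Set.Ioo (0 : ℝ) 1) (s : 𝒮) : PMF 𝒮 :=
  (walkLength α hα).bind fun t => walk R t s

/-- The transition matrix with rows `R`. -/
def rowsMatrix (R : 𝒮 → PMF 𝒮) : Matrix 𝒮 𝒮 ℝ := fun s s' => (R s s').toReal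

theorem walk_apply (R : 𝒮 → PMF 𝒮) (t : ℕ) (s s' : 𝒮) :
    (walk R t s s').toReal = (rowsMatrix R ^ t) s s' := by
  induction t generalizing s' with
  | zero => by_cases h : s = s' <;> simp [walk, PMF.pure_apply, h, eq_comm]
  | succ t ih =>
    rw [walk, PMF.bind_apply, tsum_fintype, ENNReal.toReal_sum, pow_succ, Matrix.mul_apply]
    · exact Finset.sum_congr rfl fun y _ => by rw [ENNReal.toReal_mul, ih]; rfl
    · exact fun y _ => ENNReal.mul_ne_top (PMF.apply_ne_top _ _) (PMF.apply_ne_top _ _)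

section Resolvent

attribute [local instance] Matrix.linftyOpNormedRing Matrix.linftyOpNormedAlgebra

theorem hasSum_resolvent (B : Matrix 𝒮 𝒮 ℝ) (hB : B ∈ Matrix.rowStochastic ℝ 𝒮) (α : ℝ)
    (hα : α ∈ Set.Ioo (0 : ℝ) 1) (s s' : 𝒮) :
    HasSum (fun t : ℕ => α ^ t * (B ^ t) s s') ((1 - α • B)⁻¹ s s') := by
  have hnorm : ‖α • B‖ < 1 := by
    have h1 : ‖B‖ ≤ 1 := by
      rw [Matrix.linfty_opNorm_def]
      have h : (Finset.univ.sup fun i => ∑ j, ‖B i j‖₊) ≤ (1 : NNReal) := by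
        refine Finset.sup_le fun i _ => ?_
        rw [← NNReal.coe_le_coe]
        push_cast
        refine le_of_eq ?_
        rw [← Matrix.sum_row_of_mem_rowStochastic hB i]
        exact Finset.sum_congr rfl fun j _ =>
          Real.norm_of_nonneg (Matrix.nonneg_of_mem_rowStochastic hB)
      exact_mod_cast h
    calc ‖α • B‖ ≤ ‖α‖ * ‖B‖ := norm_smul_le _ _
      _ ≤ α * 1 := by
        rw [Real.norm_of_nonneg hα.1.le]
        exact mul_le_mul_of_nonneg_left h1 hα.1.le
      _ < 1 := by simpa using hα.2
  have hsum : HasSum (fun t : ℕ => (α • B) ^ t) (∑' t : ℕ, (α • B) ^ t) :=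
    (summable_geometric_of_norm_lt_one hnorm).hasSum
  have hinv : (1 - α • B)⁻¹ = ∑' t : ℕ, (α • B) ^ t :=
    Matrix.inv_eq_right_inv (mul_neg_geom_series _ hnorm)
  rw [← hinv] at hsum
  have h2 := Pi.hasSum.1 (Pi.hasSum.1 hsum s) s'
  simpa [smul_pow] using h2

end Resolvent

theorem valueFn_eq (Q : Matrix 𝒮 𝒮 ℝ) (hQ : Q ∈ Matrix.rowStochastic ℝ 𝒮) (c : 𝒮 → ℝ) (α : ℝ)
    (hα : α ∈ Set.Ioo (0 : ℝ) 1) (s : 𝒮) :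
    valueFn Q c α s = (1 - α) * (1 - α • Q)⁻¹.mulVec c s := by
  have h := hasSum_sum (s := Finset.univ) fun s' _ =>
    (hasSum_resolvent Q hQ α hα s s').mul_right (c s')
  rw [valueFn, Matrix.mulVec, dotProduct, ← h.tsum_eq]
  simp only [Matrix.mulVec, dotProduct, Finset.mul_sum, mul_assoc]

/-- The discounted law started in `s` is the row of `s` of `(1 - α) (I - α R)⁻¹`. -/
theorem discountedLaw_apply (R : 𝒮 → PMF 𝒮) (α : ℝ) (hα : α ∈ Set.Ioo (0 : ℝ) 1) (s s' : 𝒮) :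
    (discountedLaw R α hα s s').toReal = (1 - α) * (1 - α • rowsMatrix R)⁻¹ s s' := by
  have hR : rowsMatrix R ∈ Matrix.rowStochastic ℝ 𝒮 := by
    rw [Matrix.mem_rowStochastic_iff_sum]
    refine ⟨fun _ _ => ENNReal.toReal_nonneg, fun i => ?_⟩
    have h : ∑ j, R i j = 1 := (tsum_fintype (fun b => R i b)).symm.trans (R i).tsum_coe
    simp only [rowsMatrix]
    rw [← ENNReal.toReal_sum fun j _ => PMF.apply_ne_top _ _, h, ENNReal.toReal_one]
  rw [← (hasSum_resolvent _ hR α hα s s').tsum_eq, ← tsum_mul_left, discountedLaw,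
    PMF.bind_apply, ENNReal.tsum_toReal_eq fun t =>
      ENNReal.mul_ne_top (PMF.apply_ne_top _ _) (PMF.apply_ne_top _ _)]
  refine tsum_congr fun t => ?_
  rw [ENNReal.toReal_mul, walk_apply, ← mul_assoc]
  congr 1
  exact ENNReal.toReal_ofReal (mul_nonneg (sub_pos.2 hα.2).le (pow_nonneg hα.1.le t))

/-- Bidirectional-EPE: run Backward-EPE, and when it has ended in the state `x`, draw for each
`s` independent samples `Z s 1, …, Z s nF` from the discounted law of the mixed matrix started in
`s`, and return the estimates `x.val s + (1 / nF) ∑ᵢ x.res (Z s i)`. -/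
def bidirectionalEPE [Nonempty 𝒮] (P : 𝒮 → PMF 𝒮) (c : 𝒮 → ℝ) (α : ℝ)
    (hα : α ∈ Set.Ioo (0 : ℝ) 1) (A : 𝒮 → 𝒮 → Bool) (ε : ℝ) (nB nF : ℕ) [NeZero nB] :
    PMF (Option (𝒮 → ℝ)) :=
  (backwardEPE P c α A ε nB).bind fun o =>
    match o with
    | none => PMF.pure none
    | some x =>
      (indepPMF fun si : 𝒮 × Fin nF => discountedLaw (x.mixedRow P) α hα si.1).map fun Z =>
        some fun s => x.val s + 1 / (nF : ℝ) * ∑ i, x.res (Z (s, i))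

/-! ### The sample sizes -/

/-- The least positive entry of `Q`. -/
def minPosEntry (Q : Matrix 𝒮 𝒮 ℝ) : ℝ := sInf {q : ℝ | 0 < q ∧ ∃ i j, Q i j = q}

/-- The forward sample size `n_F^*`; `S` is the number of states. -/
def nFstar (S : ℕ) (ε εrel εabs δ : ℝ) : ℝ :=
  324 * ε * Real.log (4 * S / δ) / (εrel ^ 2 * εabs)

/-- The backward sample size `n_B^*`. -/
def nBstar (Q : Matrix 𝒮 𝒮 ℝ) (c : 𝒮 → ℝ) (α εrel εabs δ : ℝ) : ℝ :=
  3 * Real.log (4 * (Fintype.card 𝒮 : ℝ) ^ 2 / δ) /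
      (Real.log (1 + εrel / 2) ^ 2 * minPosEntry Q) *
    (⌈Real.log (2 * ‖c‖ / εabs) / (1 - α)⌉ : ℝ) ^ 2

end EPE

end

/-! Call a family of rows `R` a completion of a state of Backward-EPE if it agrees with all recorded
rows and charges only entries that the true rows charge. Each push preserves, for all completions at
once, the identity `v̂ - α R v̂ + (1 - α) r = (1 - α) c`. Inverting `I - α R` gives `v_R = v̂ + E
r(Z)`, where `Z` follows the discounted law of `R` (`State.Invariant.valueFn_eq`). The mixed matrix
is a completion, so, given the backward phase, the forward phase is an unbiased estimate of `v_R`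
for the mixed matrix `R`, not of `v`. The error splits into the sampling error around `v_R` and the
perturbation `v_R - v`.

Sampling error: `0 ≤ r ≤ ε` at termination, so a Chernoff bound with a relative and an absolute part
applies for each start state (`State.Invariant.expect_forward_le`).

Perturbation: if every entry of `R` has relative error at most `η`, its `t`-step probabilities are
within factors `(1 ± η)^t` of the true ones. Cutting the series at `N` terms costs at most `α^N ‖c‖`
(`abs_valueFn_sub_le`). The size `n_B^*` makes each fresh row fail this entrywise test with
probability at most `δ / (2S)` (`exists_row_test`).

Which rows are sampled depends on earlier samples. A potential that counts bad rows, with weight `δ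
/ (2S)` for rows not yet drawn, is a supermartingale starting at `δ / 2`, so some recorded row is
bad with probability at most `δ / 2`.

Termination: `∑ v̂` grows by at least `(1 - α) ε` per round while `v̂ ≤ ‖c‖`. The number of rounds
thus has a deterministic bound, and the loop may be replaced by a finite iteration. -/

noncomputable section

namespace EPE

/-! ### Expectations and product laws -/

section Expectation

variable {β γ ι : Type*}

/-- The expectation of a function with values in `[0, ∞]`. -/
def expect (p : PMF β) (g : β → ℝ≥0∞) : ℝ≥0∞ := ∑' b, p b * g b

theorem expect_pure (b : β) (g : β → ℝ≥0∞) : expect (PMF.pure b) g = g b := by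
  classical
  rw [expect, tsum_eq_single b fun b' hb' => by simp [PMF.pure_apply, hb']]
  simp

theorem expect_bind (p : PMF β) (f : β → PMF γ) (g : γ → ℝ≥0∞) :
    expect (p.bind f) g = expect p fun b => expect (f b) g := by
  simp only [expect, PMF.bind_apply, ← ENNReal.tsum_mul_right, ← ENNReal.tsum_mul_left]
  rw [ENNReal.tsum_comm]
  simp only [mul_assoc]

theorem expect_map (p : PMF β) (f : β → γ) (g : γ → ℝ≥0∞) :
    expect (p.map f) g = expect p fun b => g (f b) := by
  rw [PMF.map, expect_bind]
  simp only [Function.comp_apply, expect_pure]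

theorem expect_mono {p : PMF β} {f g : β → ℝ≥0∞} (h : ∀ b ∈ p.support, f b ≤ g b) :
    expect p f ≤ expect p g := by
  refine ENNReal.tsum_le_tsum fun b => ?_
  by_cases hb : p b = 0
  · simp [hb]
  · exact mul_le_mul_right (h b ((PMF.mem_support_iff _ _).2 hb)) _

theorem expect_const (p : PMF β) (a : ℝ≥0∞) : expect p (fun _ => a) = a := by
  rw [expect, ENNReal.tsum_mul_right, p.tsum_coe, one_mul]

theorem expect_add (p : PMF β) (f g : β → ℝ≥0∞) :
    expect p (fun b => f b + g b) = expect p f + expect p g := by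
  simp only [expect, mul_add, ENNReal.tsum_add]

theorem expect_sum (p : PMF β) (T : Finset ι) (f : ι → β → ℝ≥0∞) :
    expect p (fun b => ∑ i ∈ T, f i b) = ∑ i ∈ T, expect p (f i) := by
  classical
  induction T using Finset.induction_on with
  | empty => simpa using expect_const p 0
  | insert i T hi ih => simp only [Finset.sum_insert hi, expect_add, ih]

theorem expect_const_mul (p : PMF β) (a : ℝ≥0∞) (f : β → ℝ≥0∞) :
    expect p (fun b => a * f b) = a * expect p f := by
  simp only [expect, mul_left_comm _ a, ENNReal.tsum_mul_left]

theorem toOuterMeasure_eq_expect (p : PMF β) (s : Set β) :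
    p.toOuterMeasure s = expect p (s.indicator 1) := by
  rw [PMF.toOuterMeasure_apply, expect]
  refine tsum_congr fun b => ?_
  by_cases hb : b ∈ s <;> simp [hb]

theorem expect_indicator_le_one (p : PMF β) (s : Set β) : expect p (s.indicator 1) ≤ 1 := by
  refine (expect_mono fun b _ => ?_).trans (expect_const p 1).le
  by_cases hb : b ∈ s <;> simp [hb]

theorem expect_indicator_mono (p : PMF β) {s t : Set β} (h : s ⊆ t) :
    expect p (s.indicator 1) ≤ expect p (t.indicator 1) :=
  expect_mono fun b _ => Set.indicator_le_indicator_of_subset h (fun _ => zero_le) b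

theorem expect_indicator_union_le (p : PMF β) (s t : Set β) :
    expect p ((s ∪ t).indicator 1) ≤ expect p (s.indicator 1) + expect p (t.indicator 1) := by
  simpa only [toOuterMeasure_eq_expect] using MeasureTheory.measure_union_le (μ := p.toOuterMeasure) s t

theorem expect_indicator_iUnion_le [Fintype ι] (p : PMF β) (s : ι → Set β) :
    expect p ((⋃ i, s i).indicator 1) ≤ ∑ i, expect p ((s i).indicator 1) := by
  simpa only [toOuterMeasure_eq_expect] using
    MeasureTheory.measure_iUnion_fintype_le p.toOuterMeasure s

theorem sum_toReal_eq_one [Fintype β] (p : PMF β) : ∑ b, (p b).toReal = 1 := by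
  rw [← ENNReal.toReal_sum fun b _ => p.apply_ne_top b, ← tsum_fintype (L := .unconditional β) (fun b => p b), p.tsum_coe,
    ENNReal.toReal_one]

theorem expect_ofReal [Fintype β] (p : PMF β) {g : β → ℝ} (hg : ∀ b, 0 ≤ g b) :
    expect p (fun b => ENNReal.ofReal (g b)) = ENNReal.ofReal (∑ b, (p b).toReal * g b) := by
  rw [expect, tsum_fintype,
    ENNReal.ofReal_sum_of_nonneg fun b _ => mul_nonneg ENNReal.toReal_nonneg (hg b)]
  refine Finset.sum_congr rfl fun b _ => ?_
  rw [ENNReal.ofReal_mul ENNReal.toReal_nonneg, ENNReal.ofReal_toReal (p.apply_ne_top b)]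

theorem indepPMF_apply [Fintype ι] [DecidableEq ι] [Fintype β] (p : ι → PMF β) (z : ι → β) :
    indepPMF p z = ∏ i, p i (z i) := rfl

theorem apply_ne_zero_of_mem_support_indepPMF [Fintype ι] [DecidableEq ι] [Fintype β]
    {p : ι → PMF β} {z : ι → β} (hz : z ∈ (indepPMF p).support) (i : ι) : p i (z i) ≠ 0 := by
  rw [PMF.mem_support_iff, indepPMF_apply, Finset.prod_ne_zero_iff] at hz
  exact hz i (Finset.mem_univ i)

theorem expect_indepPMF_prod [Fintype ι] [DecidableEq ι] [Fintype β] (p : ι → PMF β)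
    (g : ι → β → ℝ≥0∞) :
    expect (indepPMF p) (fun z => ∏ i, g i (z i)) = ∏ i, expect (p i) (g i) := by
  simp only [expect, tsum_fintype, indepPMF_apply, ← Finset.prod_mul_distrib]
  exact (Fintype.prod_sum (fun i b => p i b * g i b)).symm

end Expectation

/-! ### Chernoff bounds -/

section Concentration

variable {β ι : Type*} [Fintype β] [Fintype ι] [DecidableEq ι]

/-- By convexity, the exponential lies below its chord between `0` and `h`. -/
theorem exp_mul_le_of_mem_unitInterval (h : ℝ) {y : ℝ} (hy0 : 0 ≤ y) (hy1 : y ≤ 1) :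
    Real.exp (h * y) ≤ 1 + y * (Real.exp h - 1) := by
  have := convexOn_exp.2 (Set.mem_univ 0) (Set.mem_univ h) (sub_nonneg.2 hy1) hy0 (by ring)
  simp only [smul_eq_mul, mul_zero, zero_add, Real.exp_zero, mul_one] at this
  rw [mul_comm h y]
  linarith

theorem expect_exp_le (q : PMF β) {y : β → ℝ} (hy0 : ∀ b, 0 ≤ y b) (hy1 : ∀ b, y b ≤ 1) (h : ℝ) :
    expect q (fun b => ENNReal.ofReal (Real.exp (h * y b))) ≤
      ENNReal.ofReal (Real.exp ((∑ b, (q b).toReal * y b) * (Real.exp h - 1))) := by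
  rw [expect_ofReal q fun b => (Real.exp_pos _).le]
  refine ENNReal.ofReal_le_ofReal ?_
  calc ∑ b, (q b).toReal * Real.exp (h * y b)
      ≤ ∑ b, (q b).toReal * (1 + y b * (Real.exp h - 1)) :=
        Finset.sum_le_sum fun b _ => mul_le_mul_of_nonneg_left
          (exp_mul_le_of_mem_unitInterval h (hy0 b) (hy1 b)) ENNReal.toReal_nonneg
    _ = (∑ b, (q b).toReal * y b) * (Real.exp h - 1) + 1 := by
        simp only [mul_add, mul_one, Finset.sum_add_distrib, sum_toReal_eq_one, Finset.sum_mul,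
          mul_assoc]
        ring
    _ ≤ _ := Real.add_one_le_exp _

/-- The exponential Markov inequality for a subfamily of independent identically distributed
variables with values in the unit interval. -/
theorem expect_indepPMF_exponential_markov {p : ι → PMF β} {q : PMF β} {n : ℕ} (e : Fin n ↪ ι)
    (he : ∀ k, p (e k) = q) {y : β → ℝ} (hy0 : ∀ b, 0 ≤ y b) (hy1 : ∀ b, y b ≤ 1) (h a : ℝ) :
    expect (indepPMF p) ({z | a ≤ h * ∑ k, y (z (e k))}.indicator 1) ≤
      ENNReal.ofReal (Real.exp (n * ((∑ b, (q b).toReal * y b) * (Real.exp h - 1)) - a)) := by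
  set m := ∑ b, (q b).toReal * y b
  set T : Finset ι := Finset.univ.map e
  -- Coordinates outside the subfamily get the factor `1`, so the product over the whole family is
  -- the exponential of the sum over the subfamily.
  let g : ι → β → ℝ≥0∞ := fun i b => if i ∈ T then ENNReal.ofReal (Real.exp (h * y b)) else 1
  have hg : ∀ z : ι → β, ∏ i, g i (z i) = ENNReal.ofReal (Real.exp (h * ∑ k, y (z (e k)))) := by
    intro z
    rw [Finset.mul_sum, Real.exp_sum, ENNReal.ofReal_prod_of_nonneg fun _ _ => (Real.exp_pos _).le]
    simp only [g]
    rw [Finset.prod_ite_mem, Finset.univ_inter, Finset.prod_map]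
  have hE : ∏ i, expect (p i) (g i) ≤
      ENNReal.ofReal (Real.exp (n * (m * (Real.exp h - 1)))) := by
    calc ∏ i, expect (p i) (g i)
        ≤ ∏ i, if i ∈ T then ENNReal.ofReal (Real.exp (m * (Real.exp h - 1))) else 1 := by
          refine Finset.prod_le_prod' fun i _ => ?_
          by_cases hi : i ∈ T
          · obtain ⟨k, -, rfl⟩ := Finset.mem_map.1 hi
            simp only [g, hi, if_true, he]
            exact expect_exp_le q hy0 hy1 h
          · simp only [g, hi, if_false, expect_const, le_refl]
      _ = _ := by
          rw [Finset.prod_ite_mem, Finset.univ_inter, Finset.prod_const, Finset.card_map,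
            Finset.card_univ, Fintype.card_fin, ← ENNReal.ofReal_pow (Real.exp_pos _).le,
            ← Real.exp_nat_mul]
  calc expect (indepPMF p) ({z | a ≤ h * ∑ k, y (z (e k))}.indicator 1)
      ≤ expect (indepPMF p) (fun z => ENNReal.ofReal (Real.exp (-a)) * ∏ i, g i (z i)) := by
        refine expect_mono fun z _ => ?_
        by_cases hz : a ≤ h * ∑ k, y (z (e k))
        · rw [Set.indicator_of_mem (by exact hz), hg, ← ENNReal.ofReal_mul (Real.exp_pos _).le,
            ← Real.exp_add, Pi.one_apply, ENNReal.one_le_ofReal]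
          exact Real.one_le_exp (by linarith)
        · rw [Set.indicator_of_notMem (by exact hz)]
          exact zero_le
    _ ≤ ENNReal.ofReal (Real.exp (-a)) * ENNReal.ofReal (Real.exp (n * (m * (Real.exp h - 1)))) := by
        rw [expect_const_mul, expect_indepPMF_prod]
        exact mul_le_mul_right hE _
    _ = _ := by
        rw [← ENNReal.ofReal_mul (Real.exp_pos _).le, ← Real.exp_add]
        congr 2
        ring

/-- A two-sided tail bound: `h` is the parameter of the exponential Markov inequality and `d` the
deviation of the sample mean. -/
theorem expect_indepPMF_deviation {p : ι → PMF β} {q : PMF β} {n : ℕ} (hn : 0 < n) (e : Fin n ↪ ι)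
    (he : ∀ k, p (e k) = q) {y : β → ℝ} (hy0 : ∀ b, 0 ≤ y b) (hy1 : ∀ b, y b ≤ 1) {h d m x : ℝ}
    (hh : 0 ≤ h) (hm : m = ∑ b, (q b).toReal * y b)
    (hup : n * (m * (Real.exp h - 1 - h) - h * d) ≤ -x)
    (hlow : n * (m * (Real.exp (-h) - 1 + h) - h * d) ≤ -x) :
    expect (indepPMF p) ({z | d < |1 / (n : ℝ) * ∑ k, y (z (e k)) - m|}.indicator 1) ≤
      2 * ENNReal.ofReal (Real.exp (-x)) := by
  have hn' : (0 : ℝ) < n := Nat.cast_pos.2 hn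
  have hsub : {z : ι → β | d < |1 / (n : ℝ) * ∑ k, y (z (e k)) - m|} ⊆
      {z | h * (n * (m + d)) ≤ h * ∑ k, y (z (e k))} ∪
        {z | -h * (n * (m - d)) ≤ -h * ∑ k, y (z (e k))} := by
    intro z hz
    have hz' : d < |1 / (n : ℝ) * ∑ k, y (z (e k)) - m| := hz
    have hs : ∑ k, y (z (e k)) = n * (1 / (n : ℝ) * ∑ k, y (z (e k))) := by field_simp
    rcases lt_abs.1 hz' with h1 | h1
    · left
      refine mul_le_mul_of_nonneg_left ?_ hh
      rw [hs]
      exact mul_le_mul_of_nonneg_left (by linarith) hn'.le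
    · right
      refine mul_le_mul_of_nonpos_left ?_ (neg_nonpos.2 hh)
      rw [hs]
      exact mul_le_mul_of_nonneg_left (by linarith) hn'.le
  refine (expect_indicator_mono _ hsub).trans ((expect_indicator_union_le _ _ _).trans ?_)
  rw [two_mul]
  refine add_le_add ?_ ?_
  · refine (expect_indepPMF_exponential_markov e he hy0 hy1 h _).trans
      (ENNReal.ofReal_le_ofReal (Real.exp_le_exp.2 (le_trans (le_of_eq ?_) hup)))
    rw [← hm]; ring
  · refine (expect_indepPMF_exponential_markov e he hy0 hy1 (-h) _).trans
      (ENNReal.ofReal_le_ofReal (Real.exp_le_exp.2 (le_trans (le_of_eq ?_) hlow)))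
    rw [← hm]; ring

/-- This follows from `1 + h + h²/2 ≤ exp h`, because `(1 + h + h²/2)(1 - h + h²/2) = 1 + h⁴/4 ≥ 1`.
-/
theorem exp_neg_le_quadratic {h : ℝ} (hh : 0 ≤ h) : Real.exp (-h) ≤ 1 - h + h ^ 2 / 2 := by
  have h1 := Real.quadratic_le_exp_of_nonneg hh
  rw [Real.exp_neg, inv_le_comm₀ (Real.exp_pos h) (by nlinarith)]
  refine le_trans ?_ h1
  rw [inv_le_iff_one_le_mul₀ (by nlinarith)]
  nlinarith [pow_nonneg hh 4]

/-- The multiplicative Chernoff bound. -/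
theorem expect_indepPMF_relative_deviation {p : ι → PMF β} {q : PMF β} {n : ℕ} (hn : 0 < n)
    (e : Fin n ↪ ι) (he : ∀ k, p (e k) = q) {y : β → ℝ} (hy0 : ∀ b, 0 ≤ y b)
    (hy1 : ∀ b, y b ≤ 1) {η m : ℝ} (hη0 : 0 ≤ η) (hη1 : η ≤ 1 / 2)
    (hm : m = ∑ b, (q b).toReal * y b) :
    expect (indepPMF p) ({z | η * m < |1 / (n : ℝ) * ∑ k, y (z (e k)) - m|}.indicator 1) ≤
      2 * ENNReal.ofReal (Real.exp (-(n * m * η ^ 2 / 3))) := by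
  have hm0 : 0 ≤ m := hm ▸ Finset.sum_nonneg fun b _ => mul_nonneg ENNReal.toReal_nonneg (hy0 b)
  have hnm : 0 ≤ n * m := mul_nonneg (Nat.cast_nonneg n) hm0
  refine expect_indepPMF_deviation hn e he hy0 hy1 hη0 hm ?_ ?_
  -- With `h = η` and `d = η m` the exponent is at most `n m η² (2/3 - 1)`, the source of the factor
  -- `1/3`. The cubic Taylor remainder fits because `η ≤ 1/2`.
  · have h1 : Real.exp η ≤ 1 + η + 2 / 3 * η ^ 2 := by
      have h2 := Real.exp_bound' hη0 (by linarith) (n := 3) (by norm_num)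
      simp only [Finset.sum_range_succ, Finset.sum_range_zero, Nat.factorial] at h2
      norm_num at h2
      nlinarith [sq_nonneg η]
    nlinarith [mul_le_mul_of_nonneg_left h1 hnm]
  · have h1 := exp_neg_le_quadratic hη0
    nlinarith [mul_le_mul_of_nonneg_left h1 hnm, mul_nonneg hnm (sq_nonneg η)]

/-- A Chernoff bound for a deviation with a relative part `a` and an absolute part `b`. -/
theorem expect_indepPMF_mixed_deviation {p : ι → PMF β} {q : PMF β} {n : ℕ} (hn : 0 < n)
    (e : Fin n ↪ ι) (he : ∀ k, p (e k) = q) {y : β → ℝ} (hy0 : ∀ b, 0 ≤ y b)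
    (hy1 : ∀ b, y b ≤ 1) {a b m : ℝ} (ha0 : 0 ≤ a) (ha1 : a ≤ 1)
    (hm : m = ∑ b, (q b).toReal * y b) :
    expect (indepPMF p) ({z | a * m + b < |1 / (n : ℝ) * ∑ k, y (z (e k)) - m|}.indicator 1) ≤
      2 * ENNReal.ofReal (Real.exp (-(n * (a * b)))) := by
  have hm0 : 0 ≤ m := hm ▸ Finset.sum_nonneg fun b _ => mul_nonneg ENNReal.toReal_nonneg (hy0 b)
  have hnm : 0 ≤ n * m := mul_nonneg (Nat.cast_nonneg n) hm0
  refine expect_indepPMF_deviation hn e he hy0 hy1 ha0 hm ?_ ?_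
  -- With `h = a` the relative part of the deviation contributes `-a² m`, which absorbs the
  -- second-order term `m (exp a - 1 - a)`; only `-a b` is left.
  · have h1 : Real.exp a ≤ 1 + a + a ^ 2 := by
      have := abs_le.1 (Real.abs_exp_sub_one_sub_id_le (x := a) (by rwa [abs_of_nonneg ha0]))
      linarith [this.2]
    nlinarith [mul_le_mul_of_nonneg_left h1 hnm]
  · have h1 := exp_neg_le_quadratic ha0
    nlinarith [mul_le_mul_of_nonneg_left h1 hnm, mul_nonneg hnm (sq_nonneg a)]

end Concentration

/-! ### Loops: bounded halting and supermartingales -/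

section Loops

variable {σ : Type*} {halt : σ → Prop} [DecidablePred halt] {body : σ → PMF σ}

/-- Both total masses are `1`, so no strict inequality is possible. This spares the computation of
the non-halting mass of a loop. -/
theorem pmf_eq_of_le {β : Type*} {p q : PMF β} (h : ∀ b, p b ≤ q b) : p = q := by
  refine PMF.ext fun b => (h b).eq_of_not_lt fun hb => ?_
  have := ENNReal.tsum_lt_tsum (by rw [p.tsum_coe]; exact ENNReal.one_ne_top) h hb
  rw [p.tsum_coe, q.tsum_coe] at this
  exact lt_irrefl _ this

/-- A loop that halts within `n` rounds almost surely may be stopped after `n` rounds. -/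
theorem whileLoop_eq_map_loopIter {n : ℕ} {x : σ}
    (h : ∀ y ∈ (loopIter halt body n x).support, halt y) :
    whileLoop halt body x = (loopIter halt body n x).map some := by
  symm
  refine pmf_eq_of_le fun o => ?_
  cases o with
  | none =>
    rw [(PMF.apply_eq_zero_iff _ _).2]
    · exact zero_le
    · simp [PMF.support_map]
  | some y =>
    have h1 : (loopIter halt body n x).map some (some y) = loopIter halt body n x y := by
      rw [PMF.map_apply, tsum_eq_single y fun y' hy' => by simp [Ne.symm hy']]
      simp
    rw [h1]
    by_cases hy : halt y
    · refine le_trans ?_ (le_iSup (fun n => if halt y then loopIter halt body n x y else 0) n)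
      simp [hy]
    · rw [(PMF.apply_eq_zero_iff _ _).2 fun hs => hy (h y hs)]
      exact zero_le

/-- A supermartingale for the body of a loop, on an invariant set, is one for the loop. -/
theorem expect_loopIter_le {good : σ → Prop} (hgood : ∀ x, good x → ¬ halt x →
      ∀ y ∈ (body x).support, good y)
    {Φ : σ → ℝ≥0∞} (hΦ : ∀ x, good x → ¬ halt x → expect (body x) Φ ≤ Φ x) (n : ℕ) {x : σ}
    (hx : good x) : expect (loopIter halt body n x) Φ ≤ Φ x := by
  induction n generalizing x with
  | zero => rw [loopIter, expect_pure]
  | succ n ih =>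
    rw [loopIter]
    split_ifs with hh
    · rw [expect_pure]
    · rw [expect_bind]
      exact (expect_mono fun y hy => ih (hgood x hx hh y hy)).trans (hΦ x hx hh)

/-- A quantity that grows by at least `d` in each round has grown by `n * d` after `n` rounds,
unless the loop has halted. -/
theorem halt_or_le_of_mem_support_loopIter {good : σ → Prop} {f : σ → ℝ} {d : ℝ}
    (hstep : ∀ x, good x → ¬ halt x → ∀ y ∈ (body x).support, good y ∧ f x + d ≤ f y) (n : ℕ)
    {x : σ} (hx : good x) {y : σ} (hy : y ∈ (loopIter halt body n x).support) :
    good y ∧ (halt y ∨ f x + n * d ≤ f y) := by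
  induction n generalizing x with
  | zero =>
    rw [loopIter, PMF.mem_support_pure_iff] at hy
    subst hy
    exact ⟨hx, Or.inr (by simp)⟩
  | succ n ih =>
    rw [loopIter] at hy
    split_ifs at hy with hh
    · rw [PMF.mem_support_pure_iff] at hy
      subst hy
      exact ⟨hx, Or.inl hh⟩
    · obtain ⟨z, hz, hyz⟩ := (PMF.mem_support_bind_iff _ _ _).1 hy
      obtain ⟨hgz, hfz⟩ := hstep x hx hh z hz
      obtain ⟨hgy, hy'⟩ := ih hgz hyz
      refine ⟨hgy, hy'.imp_right fun h => ?_⟩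
      push_cast
      linarith

end Loops

set_option linter.unusedSectionVars false

/-! ### The invariant and termination of Backward-EPE -/

variable {𝒮 : Type*} [Fintype 𝒮] [DecidableEq 𝒮]

/-- `R` extends the recorded rows of `x` by rows whose supports are contained in those of `P`. -/
structure State.IsCompletion (x : State 𝒮) (P R : 𝒮 → PMF 𝒮) : Prop where
  row : ∀ s p, x.row s = some p → R s = p
  supp : ∀ s s', P s s' = 0 → R s s' = 0

/-- The invariant of Backward-EPE. -/
structure State.Invariant (P : 𝒮 → PMF 𝒮) (c : 𝒮 → ℝ) (α : ℝ) (x : State 𝒮) : Prop where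
  val_nonneg : ∀ s, 0 ≤ x.val s
  res_nonneg : ∀ s, 0 ≤ x.res s
  supp : ∀ s p, x.row s = some p → ∀ s', P s s' = 0 → p s' = 0
  -- Quantifying over all completions makes the identity insensitive to rows recorded later, and
  -- yields it for the mixed matrix at the end.
  balance : ∀ R, x.IsCompletion P R → ∀ s,
    x.val s - α * ∑ s', (R s s').toReal * x.val s' + (1 - α) * x.res s = (1 - α) * c s

theorem State.invariant_init (P : 𝒮 → PMF 𝒮) {c : 𝒮 → ℝ} (hc : ∀ s, 0 ≤ c s) (α : ℝ) :
    (State.init c).Invariant P c α where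
  val_nonneg _ := le_rfl
  res_nonneg := hc
  supp := by simp [State.init]
  balance := by simp [State.init]

theorem State.Invariant.isCompletion_mixedRow {P : 𝒮 → PMF 𝒮} {c : 𝒮 → ℝ} {α : ℝ} {x : State 𝒮}
    (hx : x.Invariant P c α) : x.IsCompletion P (x.mixedRow P) where
  row s p h := by simp [State.mixedRow, h]
  supp s s' h := by
    rw [State.mixedRow]
    cases hr : x.row s with
    | none => simpa using h
    | some p => simpa using hx.supp s p hr s' h

/-- Maximum principle: where `v̂` is maximal, `R v̂ ≤ v̂`, so the balance identity and `r ≥ 0` give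
`(1 - α) v̂ ≤ (1 - α) c` there. -/
theorem State.Invariant.val_le {P : 𝒮 → PMF 𝒮} {c : 𝒮 → ℝ} {α : ℝ} {x : State 𝒮}
    (hx : x.Invariant P c α) (hα : α ∈ Set.Ioo (0 : ℝ) 1) (s : 𝒮) : x.val s ≤ ‖c‖ := by
  have : Nonempty 𝒮 := ⟨s⟩
  obtain ⟨t, ht⟩ := Finite.exists_max x.val
  refine (ht s).trans ?_
  have h1 := hx.balance _ hx.isCompletion_mixedRow t
  have h2 : ∑ s', (x.mixedRow P t s').toReal * x.val s' ≤ x.val t := by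
    calc ∑ s', (x.mixedRow P t s').toReal * x.val s'
        ≤ ∑ s', (x.mixedRow P t s').toReal * x.val t :=
          Finset.sum_le_sum fun s' _ => mul_le_mul_of_nonneg_left (ht s') ENNReal.toReal_nonneg
      _ = x.val t := by rw [← Finset.sum_mul, sum_toReal_eq_one, one_mul]
  have h3 : (1 - α) * x.val t ≤ (1 - α) * c t := by
    nlinarith [mul_le_mul_of_nonneg_left h2 hα.1.le, mul_nonneg (sub_pos.2 hα.2).le
      (hx.res_nonneg t)]
  exact (le_of_mul_le_mul_left h3 (sub_pos.2 hα.2)).trans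
    ((le_abs_self _).trans (norm_le_pi_norm c t))

theorem State.mem_enc {x : State 𝒮} {s : 𝒮} : s ∈ x.enc ↔ x.row s ≠ none := by
  simp [State.enc, Option.isSome_iff_ne_none]

theorem State.record_row_of_mem {n : ℕ} [NeZero n] (x : State 𝒮) {T : Finset 𝒮}
    (X : T × Fin n → 𝒮) {s : 𝒮} (hs : s ∈ T) :
    (x.record T X).row s = some (empirical fun i => X (⟨s, hs⟩, i)) := by
  simp [State.record, hs]

theorem State.record_row_of_notMem {n : ℕ} [NeZero n] (x : State 𝒮) {T : Finset 𝒮}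
    (X : T × Fin n → 𝒮) {s : 𝒮} (hs : s ∉ T) : (x.record T X).row s = x.row s := by
  simp [State.record, hs]

/-- Recording fresh samples preserves the invariant. -/
theorem State.Invariant.record {P : 𝒮 → PMF 𝒮} {c : 𝒮 → ℝ} {α : ℝ} {x : State 𝒮}
    (hx : x.Invariant P c α) {n : ℕ} [NeZero n] {T : Finset 𝒮} (hT : Disjoint T x.enc)
    {X : T × Fin n → 𝒮} (hX : ∀ i, P i.1 (X i) ≠ 0) : (x.record T X).Invariant P c α where
  val_nonneg := hx.val_nonneg
  res_nonneg := hx.res_nonneg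
  supp s p h s' hs' := by
    by_cases hs : s ∈ T
    · rw [x.record_row_of_mem X hs, Option.some_inj] at h
      subst h
      rw [PMF.apply_eq_zero_iff, empirical, PMF.support_map]
      rintro ⟨i, -, rfl⟩
      exact hX (⟨s, hs⟩, i) hs'
    · rw [x.record_row_of_notMem X hs] at h
      exact hx.supp s p h s' hs'
  balance R hR := by
    -- As `T` avoids the encountered states, old rows are kept and recording only shrinks the set of
    -- completions.
    refine hx.balance R ⟨fun s p h => hR.row s p ?_, hR.supp⟩
    rwa [x.record_row_of_notMem X fun hs =>
      Finset.disjoint_left.1 hT hs (State.mem_enc.2 (by simp [h]))]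

theorem State.Qhat_nonneg (x : State 𝒮) (s s' : 𝒮) : 0 ≤ x.Qhat s s' := by
  rw [State.Qhat]
  cases x.row s with
  | none => exact le_rfl
  | some p => exact ENNReal.toReal_nonneg

/-- A push preserves the invariant, if all rows with a positive entry at the state are known. -/
theorem State.Invariant.push {P : 𝒮 → PMF 𝒮} {c : 𝒮 → ℝ} {α : ℝ} (hα : α ∈ Set.Icc (0 : ℝ) 1)
    {x : State 𝒮} (hx : x.Invariant P c α) {t : 𝒮} (ht : ∀ s, x.row s = none → P s t = 0) :
    (x.push α t).Invariant P c α where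
  val_nonneg s := by
    simp only [State.push]
    split_ifs
    · exact add_nonneg (hx.val_nonneg s) (mul_nonneg (sub_nonneg.2 hα.2) (hx.res_nonneg s))
    · exact hx.val_nonneg s
  res_nonneg s := by
    have h : 0 ≤ α * x.Qhat s t * x.res t :=
      mul_nonneg (mul_nonneg hα.1 (x.Qhat_nonneg s t)) (hx.res_nonneg t)
    simp only [State.push]
    split_ifs
    · exact h
    · exact add_nonneg (hx.res_nonneg s) h
  supp := hx.supp
  balance R hR s := by
    have hR' : x.IsCompletion P R := ⟨hR.row, hR.supp⟩
    -- The push uses `0` for an unknown row. This is the correct entry for every completion, since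
    -- `P s t = 0` forces `R s t = 0`.
    have hQ : x.Qhat s t = (R s t).toReal := by
      rw [State.Qhat]
      cases hr : x.row s with
      | none => simp [hR.supp s t (ht s hr)]
      | some p => simp [hR'.row s p hr]
    have hval : ∀ s', (x.push α t).val s' = x.val s' + if s' = t then (1 - α) * x.res t else 0 := by
      intro s'
      simp only [State.push]
      split_ifs with h
      · rw [h]
      · rw [add_zero]
    have hres : (x.push α t).res s =
        x.res s - (if s = t then x.res t else 0) + α * (R s t).toReal * x.res t := by
      simp only [State.push, hQ]
      split_ifs with h
      · rw [h]; ring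
      · ring
    have hb := hx.balance R hR' s
    rw [hres]
    simp only [hval, mul_add, Finset.sum_add_distrib, mul_ite, mul_zero, Finset.sum_ite_eq',
      Finset.mem_univ, if_true]
    split_ifs
    · linear_combination hb
    · linear_combination hb

theorem mem_argmax {r : 𝒮 → ℝ} {s : 𝒮} : s ∈ argmax r ↔ ∀ s', r s' ≤ r s := by
  simp [argmax]

theorem mem_support_backwardStep [Nonempty 𝒮] {P : 𝒮 → PMF 𝒮} {α : ℝ} {A : 𝒮 → 𝒮 → Bool} {n : ℕ}
    [NeZero n] {x y : State 𝒮} (hy : y ∈ (backwardStep P α A n x).support) :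
    ∃ t ∈ argmax x.res, ∃ X : ↥(inNbrs A t \ x.enc) × Fin n → 𝒮,
      (∀ i, P i.1 (X i) ≠ 0) ∧ y = (x.record _ X).push α t := by
  obtain ⟨t, ht, hy⟩ := (PMF.mem_support_bind_iff _ _ _).1 hy
  obtain ⟨X, hX, rfl⟩ := (PMF.mem_support_map_iff _ _ _).1 hy
  exact ⟨t, (PMF.mem_support_uniformOfFinset_iff _ _).1 ht, X,
    fun i => apply_ne_zero_of_mem_support_indepPMF hX i, rfl⟩

theorem State.Invariant.backwardStep [Nonempty 𝒮] {P : 𝒮 → PMF 𝒮} {c : 𝒮 → ℝ} {α : ℝ}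
    (hα : α ∈ Set.Icc (0 : ℝ) 1) {A : 𝒮 → 𝒮 → Bool} (hA : ∀ s s', A s s' = false → P s s' = 0) {n : ℕ} [NeZero n]
    {x y : State 𝒮} (hx : x.Invariant P c α) (hy : y ∈ (backwardStep P α A n x).support) :
    y.Invariant P c α := by
  obtain ⟨t, -, X, hX, rfl⟩ := mem_support_backwardStep hy
  refine (hx.record Finset.sdiff_disjoint hX).push hα fun s hs => hA s t ?_
  by_contra hst
  have hst' : s ∈ inNbrs A t := by simpa [inNbrs] using hst
  by_cases he : s ∈ x.enc
  · rw [x.record_row_of_notMem X (by simp [he])] at hs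
    exact State.mem_enc.1 he hs
  · rw [x.record_row_of_mem X (Finset.mem_sdiff.2 ⟨hst', he⟩)] at hs
    exact Option.some_ne_none _ hs

/-- The progress measure for termination: before halting, the maximal residual is at least `ε`, and
a fraction `1 - α` of it moves into the estimate. -/
theorem sum_val_le_of_mem_support_backwardStep [Nonempty 𝒮] {P : 𝒮 → PMF 𝒮} {c : 𝒮 → ℝ} {α : ℝ}
    (hα : α ≤ 1) {A : 𝒮 → 𝒮 → Bool} {n : ℕ} [NeZero n] {ε : ℝ} {x y : State 𝒮}
    (hx : x.Invariant P c α) (hε : 0 ≤ ε) (hres : ¬ ‖x.res‖ ≤ ε)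
    (hy : y ∈ (EPE.backwardStep P α A n x).support) :
    ∑ s, x.val s + (1 - α) * ε ≤ ∑ s, y.val s := by
  obtain ⟨t, ht, X, -, rfl⟩ := mem_support_backwardStep hy
  have h1 : ε ≤ x.res t := by
    by_contra hlt
    refine hres ((pi_norm_le_iff_of_nonneg hε).2 fun s => ?_)
    rw [Real.norm_of_nonneg (hx.res_nonneg s)]
    exact (mem_argmax.1 ht s).trans (not_le.1 hlt).le
  have h2 : ∀ s, ((x.record _ X).push α t).val s =
      x.val s + if s = t then (1 - α) * x.res t else 0 := by
    intro s
    simp only [State.push, State.record]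
    split_ifs with h
    · rw [h]
    · rw [add_zero]
  simp only [h2, Finset.sum_add_distrib, Finset.sum_ite_eq', Finset.mem_univ, if_true]
  linarith [mul_le_mul_of_nonneg_left h1 (sub_nonneg.2 hα)]

open Classical in
/-- Backward-EPE halts after a bounded number of rounds, in a state that satisfies the
invariant. -/
theorem exists_backwardEPE_eq_map [Nonempty 𝒮] {P : 𝒮 → PMF 𝒮} {c : 𝒮 → ℝ} (hc : ∀ s, 0 ≤ c s)
    {α : ℝ} (hα : α ∈ Set.Ioo (0 : ℝ) 1) {A : 𝒮 → 𝒮 → Bool}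
    (hA : ∀ s s', A s s' = false → P s s' = 0) {ε : ℝ} (hε : 0 < ε) (n : ℕ) [NeZero n] :
    ∃ N, backwardEPE P c α A ε n =
        (loopIter (fun x => ‖x.res‖ ≤ ε) (backwardStep P α A n) N (State.init c)).map some ∧
      ∀ x ∈ (loopIter (fun x => ‖x.res‖ ≤ ε) (backwardStep P α A n) N (State.init c)).support,
        x.Invariant P c α ∧ ‖x.res‖ ≤ ε := by
  have hd : 0 < (1 - α) * ε := mul_pos (sub_pos.2 hα.2) hε
  -- After `N` rounds without halting, `∑ v̂` would exceed its upper bound `S ‖c‖`.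
  obtain ⟨N, hN⟩ := exists_nat_gt (Fintype.card 𝒮 * ‖c‖ / ((1 - α) * ε))
  rw [div_lt_iff₀ hd] at hN
  have key : ∀ x ∈ (loopIter (fun x => ‖x.res‖ ≤ ε) (backwardStep P α A n) N
      (State.init c)).support, x.Invariant P c α ∧ ‖x.res‖ ≤ ε := by
    intro x hx
    obtain ⟨hxi, hx'⟩ := halt_or_le_of_mem_support_loopIter (halt := fun x : State 𝒮 => ‖x.res‖ ≤ ε)
      (body := backwardStep P α A n) (good := State.Invariant P c α)
      (f := fun x => ∑ s, x.val s) (d := (1 - α) * ε)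
      (fun x hx hh y hy => ⟨hx.backwardStep (Set.Ioo_subset_Icc_self hα) hA hy,
        sum_val_le_of_mem_support_backwardStep hα.2.le hx hε.le hh hy⟩) N
      (State.invariant_init P hc α) hx
    refine ⟨hxi, hx'.resolve_right fun h => ?_⟩
    have h1 : ∑ s, x.val s ≤ Fintype.card 𝒮 * ‖c‖ := by
      have := Finset.sum_le_card_nsmul Finset.univ x.val ‖c‖ fun s _ => hxi.val_le hα s
      simpa using this
    have h2 : ∑ s, (State.init c).val s = 0 := by simp [State.init]
    linarith
  exact ⟨N, whileLoop_eq_map_loopIter fun y hy => (key y hy).2, key⟩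

/-! ### The potential of bad rows -/

open Classical in
/-- The potential of a state: the expected number of bad rows, where a row that has not been
recorded yet is counted with the weight `b`. -/
def potential (bad : 𝒮 → PMF 𝒮 → Prop) (b : ℝ≥0∞) (x : State 𝒮) : ℝ≥0∞ :=
  ∑ s, (x.row s).elim b fun p => if bad s p then 1 else 0

theorem potential_init (bad : 𝒮 → PMF 𝒮 → Prop) (b : ℝ≥0∞) (c : 𝒮 → ℝ) :
    potential bad b (State.init c) = Fintype.card 𝒮 * b := by
  simp [potential, State.init]

theorem one_le_potential {bad : 𝒮 → PMF 𝒮 → Prop} {b : ℝ≥0∞} {x : State 𝒮} {s : 𝒮} {p : PMF 𝒮}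
    (hs : x.row s = some p) (hp : bad s p) : 1 ≤ potential bad b x := by
  classical
  refine le_trans ?_ (Finset.single_le_sum (fun _ _ => zero_le) (Finset.mem_univ s))
  simp [hs, hp]

/-- Condition on the pushed state. Recorded rows never change, and a newly drawn row trades its
weight `b` for a probability of being bad that is at most `b`. Since the samples are fresh, it does
not matter how past samples influenced the choice of rows. -/
theorem expect_backwardStep_potential_le [Nonempty 𝒮] {P : 𝒮 → PMF 𝒮} {α : ℝ} {A : 𝒮 → 𝒮 → Bool}
    {n : ℕ} [NeZero n] {bad : 𝒮 → PMF 𝒮 → Prop} {b : ℝ≥0∞}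
    (hbad : ∀ (T : Finset 𝒮) (s : 𝒮) (hs : s ∈ T),
      expect (indepPMF fun si : T × Fin n => P si.1)
        ({X | bad s (empirical fun i => X (⟨s, hs⟩, i))}.indicator 1) ≤ b)
    (x : State 𝒮) :
    expect (backwardStep P α A n x) (potential bad b) ≤ potential bad b x := by
  classical
  rw [backwardStep, expect_bind]
  refine (expect_mono fun t _ => ?_).trans (expect_const _ _).le
  rw [expect_map]
  unfold potential
  rw [expect_sum]
  refine Finset.sum_le_sum fun s _ => ?_
  by_cases hs : s ∈ inNbrs A t \ x.enc
  · have h1 : x.row s = none := by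
      by_contra h
      exact (Finset.mem_sdiff.1 hs).2 (State.mem_enc.2 h)
    rw [h1, Option.elim_none]
    refine le_trans (expect_mono fun X _ => ?_) (hbad _ s hs)
    change ((x.record _ X).row s).elim b _ ≤ _
    rw [x.record_row_of_mem X hs, Option.elim_some]
    simp [Set.indicator_apply]
  · refine (expect_mono fun X _ => ?_).trans (expect_const _ _).le
    change ((x.record _ X).row s).elim b _ ≤ _
    rw [x.record_row_of_notMem X hs]

/-! ### The resolvent identity for completions -/

theorem rowsMatrix_mem_rowStochastic (R : 𝒮 → PMF 𝒮) :
    rowsMatrix R ∈ Matrix.rowStochastic ℝ 𝒮 :=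
  Matrix.mem_rowStochastic_iff_sum.2
    ⟨fun _ _ => ENNReal.toReal_nonneg, fun i => sum_toReal_eq_one (R i)⟩

theorem isUnit_det_one_sub_smul {B : Matrix 𝒮 𝒮 ℝ} (hB : B ∈ Matrix.rowStochastic ℝ 𝒮) {α : ℝ}
    (hα : α ∈ Set.Ioo (0 : ℝ) 1) : IsUnit (1 - α • B).det := by
  by_contra h
  -- A singular matrix has inverse `0` by convention, but the series for a diagonal entry of the
  -- resolvent has nonnegative terms and first term `1`.
  have hinv := Matrix.nonsing_inv_apply_not_isUnit _ h
  cases isEmpty_or_nonempty 𝒮 with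
  | inl _ => exact h (by simp)
  | inr hne =>
    obtain ⟨s⟩ := hne
    have hs := hasSum_resolvent B hB α hα s s
    rw [hinv, Matrix.zero_apply] at hs
    have h0 := hs.summable.le_tsum 0 fun t _ => mul_nonneg (pow_nonneg hα.1.le t)
      (Matrix.nonneg_of_mem_rowStochastic (pow_mem hB t))
    rw [hs.tsum_eq] at h0
    norm_num at h0

/-- The estimate of a state that satisfies the invariant differs from the value function of every
completion by the discounted mean of the residual. -/
theorem State.Invariant.valueFn_eq {P : 𝒮 → PMF 𝒮} {c : 𝒮 → ℝ} {α : ℝ} {x : State 𝒮}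
    (hx : x.Invariant P c α) (hα : α ∈ Set.Ioo (0 : ℝ) 1) {R : 𝒮 → PMF 𝒮}
    (hR : x.IsCompletion P R) (s : 𝒮) :
    valueFn (rowsMatrix R) c α s =
      x.val s + ∑ b, (discountedLaw R α hα s b).toReal * x.res b := by
  have hB := rowsMatrix_mem_rowStochastic R
  have h1 : (1 - α • rowsMatrix R).mulVec x.val = (1 - α) • (c - x.res) := by
    funext s
    have := hx.balance R hR s
    rw [Matrix.sub_mulVec, Matrix.one_mulVec, Matrix.smul_mulVec]
    simp only [Pi.sub_apply, Pi.smul_apply, smul_eq_mul, Matrix.mulVec, dotProduct, rowsMatrix]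
    linear_combination this
  have h2 : x.val = (1 - α) • (1 - α • rowsMatrix R)⁻¹.mulVec (c - x.res) := by
    rw [← Matrix.mulVec_smul, ← h1, Matrix.mulVec_mulVec,
      Matrix.nonsing_inv_mul _ (isUnit_det_one_sub_smul hB hα), Matrix.one_mulVec]
  have h3 : ∑ b, (discountedLaw R α hα s b).toReal * x.res b =
      (1 - α) * (1 - α • rowsMatrix R)⁻¹.mulVec x.res s := by
    simp only [discountedLaw_apply, Matrix.mulVec, dotProduct, Finset.mul_sum, mul_assoc]
  rw [EPE.valueFn_eq _ hB c α hα, h3]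
  conv_rhs => rw [h2]
  rw [Matrix.mulVec_sub]
  simp only [Pi.sub_apply, Pi.smul_apply, smul_eq_mul]
  ring

/-! ### Perturbation of the value function -/

section Perturbation

variable {B B' : Matrix 𝒮 𝒮 ℝ} {c : 𝒮 → ℝ} {α : ℝ}

theorem mulVec_nonneg_of_mem_rowStochastic (hB : B ∈ Matrix.rowStochastic ℝ 𝒮)
    (hc : ∀ s, 0 ≤ c s) (s : 𝒮) : 0 ≤ B.mulVec c s :=
  Finset.sum_nonneg fun j _ => mul_nonneg (Matrix.nonneg_of_mem_rowStochastic hB) (hc j)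

theorem mulVec_le_norm_of_mem_rowStochastic (hB : B ∈ Matrix.rowStochastic ℝ 𝒮) (s : 𝒮) :
    B.mulVec c s ≤ ‖c‖ := by
  calc B.mulVec c s ≤ ∑ j, B s j * ‖c‖ :=
        Finset.sum_le_sum fun j _ => mul_le_mul_of_nonneg_left
          ((le_abs_self _).trans (norm_le_pi_norm c j)) (Matrix.nonneg_of_mem_rowStochastic hB)
    _ = ‖c‖ := by rw [← Finset.sum_mul, Matrix.sum_row_of_mem_rowStochastic hB, one_mul]

theorem summable_valueFn (hB : B ∈ Matrix.rowStochastic ℝ 𝒮) (hc : ∀ s, 0 ≤ c s)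
    (hα : α ∈ Set.Ioo (0 : ℝ) 1) (s : 𝒮) : Summable fun t : ℕ => α ^ t * (B ^ t).mulVec c s :=
  Summable.of_nonneg_of_le
    (fun t => mul_nonneg (pow_nonneg hα.1.le t)
      (mulVec_nonneg_of_mem_rowStochastic (pow_mem hB t) hc s))
    (fun t => mul_le_mul_of_nonneg_left (mulVec_le_norm_of_mem_rowStochastic (pow_mem hB t) s)
      (pow_nonneg hα.1.le t))
    ((summable_geometric_of_lt_one hα.1.le hα.2).mul_right ‖c‖)

theorem valueFn_nonneg (hB : B ∈ Matrix.rowStochastic ℝ 𝒮) (hc : ∀ s, 0 ≤ c s)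
    (hα : α ∈ Set.Ioo (0 : ℝ) 1) (s : 𝒮) : 0 ≤ valueFn B c α s :=
  mul_nonneg (sub_pos.2 hα.2).le (tsum_nonneg fun t => mul_nonneg (pow_nonneg hα.1.le t)
    (mulVec_nonneg_of_mem_rowStochastic (pow_mem hB t) hc s))

/-- A comparison of the first `N` terms of two value functions. -/
theorem mul_valueFn_le (hB : B ∈ Matrix.rowStochastic ℝ 𝒮) (hB' : B' ∈ Matrix.rowStochastic ℝ 𝒮)
    (hc : ∀ s, 0 ≤ c s) (hα : α ∈ Set.Ioo (0 : ℝ) 1) {k l : ℝ} (hk0 : 0 ≤ k) (hk1 : k ≤ 1)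
    (hl : 0 ≤ l) {N : ℕ} {s : 𝒮}
    (h : ∀ t < N, k * (B ^ t).mulVec c s ≤ l * (B' ^ t).mulVec c s) :
    k * valueFn B c α s ≤ l * valueFn B' c α s + α ^ N * ‖c‖ := by
  have hα1 : 0 < 1 - α := sub_pos.2 hα.2
  have hs := summable_valueFn hB hc hα s
  have hs' := summable_valueFn hB' hc hα s
  have hhead : k * ∑ t ∈ Finset.range N, α ^ t * (B ^ t).mulVec c s ≤
      l * ∑' t : ℕ, α ^ t * (B' ^ t).mulVec c s := by
    refine le_trans ?_ (mul_le_mul_of_nonneg_left (hs'.sum_le_tsum (Finset.range N) fun t _ =>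
      mul_nonneg (pow_nonneg hα.1.le t)
        (mulVec_nonneg_of_mem_rowStochastic (pow_mem hB' t) hc s)) hl)
    rw [Finset.mul_sum, Finset.mul_sum]
    refine Finset.sum_le_sum fun t ht => ?_
    rw [mul_left_comm k, mul_left_comm l]
    exact mul_le_mul_of_nonneg_left (h t (Finset.mem_range.1 ht)) (pow_nonneg hα.1.le t)
  have hg := summable_geometric_of_lt_one hα.1.le hα.2
  have htail : ∑' t : ℕ, α ^ (t + N) * (B ^ (t + N)).mulVec c s ≤ (1 - α)⁻¹ * (α ^ N * ‖c‖) := by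
    rw [← tsum_geometric_of_lt_one hα.1.le hα.2, ← tsum_mul_right]
    refine Summable.tsum_le_tsum (fun t => ?_) ((summable_nat_add_iff N).2 hs) (hg.mul_right _)
    rw [pow_add, mul_assoc]
    exact mul_le_mul_of_nonneg_left (mul_le_mul_of_nonneg_left
      (mulVec_le_norm_of_mem_rowStochastic (pow_mem hB _) s) (pow_nonneg hα.1.le N))
      (pow_nonneg hα.1.le t)
  have htail0 : 0 ≤ (1 - α)⁻¹ * (α ^ N * ‖c‖) :=
    mul_nonneg (inv_nonneg.2 hα1.le) (mul_nonneg (pow_nonneg hα.1.le N) (norm_nonneg c))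
  have hsum : k * ∑' t : ℕ, α ^ t * (B ^ t).mulVec c s ≤
      l * (∑' t : ℕ, α ^ t * (B' ^ t).mulVec c s) + (1 - α)⁻¹ * (α ^ N * ‖c‖) := by
    rw [← hs.sum_add_tsum_nat_add N, mul_add]
    exact add_le_add hhead ((mul_le_mul_of_nonneg_left htail hk0).trans
      (mul_le_of_le_one_left htail0 hk1))
  have := mul_le_mul_of_nonneg_left hsum hα1.le
  rw [mul_add, mul_inv_cancel_left₀ hα1.ne'] at this
  rw [valueFn, valueFn]
  linarith

/-- Entrywise domination of nonnegative matrices passes to products. With factors on both sides, `k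
= 1` gives the upper bound `(1 + η)^t` and `l = 1` the lower bound `(1 - η)^t`. -/
theorem pow_apply_le_pow_apply (hB : B ∈ Matrix.rowStochastic ℝ 𝒮)
    (hB' : B' ∈ Matrix.rowStochastic ℝ 𝒮) {k l : ℝ} (hk : 0 ≤ k) (hl : 0 ≤ l)
    (h : ∀ i j, k * B i j ≤ l * B' i j) (t : ℕ) (i j : 𝒮) :
    k ^ t * (B ^ t) i j ≤ l ^ t * (B' ^ t) i j := by
  induction t generalizing j with
  | zero => simp
  | succ t ih =>
    rw [pow_succ B, pow_succ B', Matrix.mul_apply, Matrix.mul_apply, Finset.mul_sum, Finset.mul_sum]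
    refine Finset.sum_le_sum fun m _ => ?_
    calc k ^ (t + 1) * ((B ^ t) i m * B m j) = (k ^ t * (B ^ t) i m) * (k * B m j) := by ring
      _ ≤ (l ^ t * (B' ^ t) i m) * (l * B' m j) :=
        mul_le_mul (ih m) (h m j) (mul_nonneg hk (Matrix.nonneg_of_mem_rowStochastic hB))
          (mul_nonneg (pow_nonneg hl t) (Matrix.nonneg_of_mem_rowStochastic (pow_mem hB' t)))
      _ = _ := by ring

theorem pow_mulVec_le_pow_mulVec (hB : B ∈ Matrix.rowStochastic ℝ 𝒮)
    (hB' : B' ∈ Matrix.rowStochastic ℝ 𝒮) (hc : ∀ s, 0 ≤ c s) {k l : ℝ} (hk : 0 ≤ k) (hl : 0 ≤ l)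
    (h : ∀ i j, k * B i j ≤ l * B' i j) (t : ℕ) (s : 𝒮) :
    k ^ t * (B ^ t).mulVec c s ≤ l ^ t * (B' ^ t).mulVec c s := by
  simp only [Matrix.mulVec, dotProduct, Finset.mul_sum, ← mul_assoc]
  exact Finset.sum_le_sum fun j _ => mul_le_mul_of_nonneg_right
    (pow_apply_le_pow_apply hB hB' hk hl h t s j) (hc j)

/-- A relative perturbation of the transition matrix perturbs the value function by a relative and
an absolute error. -/
theorem abs_valueFn_sub_le (hB : B ∈ Matrix.rowStochastic ℝ 𝒮)
    (hB' : B' ∈ Matrix.rowStochastic ℝ 𝒮) (hc : ∀ s, 0 ≤ c s) (hα : α ∈ Set.Ioo (0 : ℝ) 1)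
    {η e d : ℝ} {N : ℕ} (hη0 : 0 ≤ η) (hη1 : η ≤ 1) (he0 : 0 ≤ e) (he1 : e ≤ 1)
    (hup : (1 + η) ^ N ≤ 1 + e) (hlow : 1 - e ≤ (1 - η) ^ N) (hd : α ^ N * ‖c‖ ≤ d)
    (h : ∀ i j, |B i j - B' i j| ≤ η * B' i j) (s : 𝒮) :
    |valueFn B c α s - valueFn B' c α s| ≤ e * valueFn B' c α s + d := by
  have h1 : 1 * valueFn B c α s ≤ (1 + e) * valueFn B' c α s + α ^ N * ‖c‖ := by
    refine mul_valueFn_le hB hB' hc hα zero_le_one le_rfl (by linarith) fun t ht => ?_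
    have := pow_mulVec_le_pow_mulVec hB hB' hc zero_le_one (by linarith : 0 ≤ 1 + η)
      (fun i j => by linarith [(abs_le.1 (h i j)).2]) t s
    rw [one_pow] at this
    refine this.trans (mul_le_mul_of_nonneg_right ?_
      (mulVec_nonneg_of_mem_rowStochastic (pow_mem hB' t) hc s))
    exact (pow_le_pow_right₀ (by linarith) ht.le).trans hup
  have h2 : (1 - e) * valueFn B' c α s ≤ 1 * valueFn B c α s + α ^ N * ‖c‖ := by
    refine mul_valueFn_le hB' hB hc hα (by linarith) (by linarith) zero_le_one fun t ht => ?_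
    have := pow_mulVec_le_pow_mulVec hB' hB hc (by linarith : 0 ≤ 1 - η) zero_le_one
      (fun i j => by linarith [(abs_le.1 (h i j)).1]) t s
    rw [one_pow] at this
    refine le_trans (mul_le_mul_of_nonneg_right ?_
      (mulVec_nonneg_of_mem_rowStochastic (pow_mem hB' t) hc s)) this
    exact hlow.trans (pow_le_pow_of_le_one (by linarith) (by linarith) ht.le)
  rw [abs_le]
  constructor <;> linarith

end Perturbation

/-! ### Accuracy of the empirical rows -/

section Sampler

variable {Q : Matrix 𝒮 𝒮 ℝ} (hQ : Q ∈ Matrix.rowStochastic ℝ 𝒮)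

theorem sampler_apply (s s' : 𝒮) : sampler Q hQ s s' = ENNReal.ofReal (Q s s') := rfl

theorem sampler_toReal (s s' : 𝒮) : (sampler Q hQ s s').toReal = Q s s' := by
  rw [sampler_apply, ENNReal.toReal_ofReal (Matrix.nonneg_of_mem_rowStochastic hQ)]

theorem minPosEntry_pos_and_le {i j : 𝒮} (h : 0 < Q i j) :
    0 < minPosEntry Q ∧ minPosEntry Q ≤ Q i j := by
  have hfin : {q : ℝ | 0 < q ∧ ∃ i j, Q i j = q}.Finite := by
    refine (Set.finite_range fun ij : 𝒮 × 𝒮 => Q ij.1 ij.2).subset ?_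
    rintro q ⟨-, i, j, rfl⟩
    exact ⟨(i, j), rfl⟩
  have hmem : Q i j ∈ {q : ℝ | 0 < q ∧ ∃ i j, Q i j = q} := ⟨h, i, j, rfl⟩
  exact ⟨(Set.Nonempty.csInf_mem ⟨_, hmem⟩ hfin).1, csInf_le hfin.bddBelow hmem⟩

/-- The empirical distribution of a row is accurate to within a relative error. -/
theorem expect_empirical_deviation_le {n : ℕ} [NeZero n] {η b : ℝ} (hη0 : 0 ≤ η)
    (hη1 : η ≤ 1 / 2) (hb : ∀ i j, 0 < Q i j → b ≤ n * Q i j * η ^ 2 / 3) (T : Finset 𝒮) (s : 𝒮)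
    (hs : s ∈ T) :
    expect (indepPMF fun si : T × Fin n => sampler Q hQ si.1)
      ({X | ∃ j, 0 < Q s j ∧
        η * Q s j < |(empirical (fun i => X (⟨s, hs⟩, i)) j).toReal - Q s j|}.indicator 1) ≤
      Fintype.card 𝒮 * (2 * ENNReal.ofReal (Real.exp (-b))) := by
  let E : 𝒮 → Set (T × Fin n → 𝒮) := fun j => {X | 0 < Q s j ∧
    η * Q s j < |(empirical (fun i => X (⟨s, hs⟩, i)) j).toReal - Q s j|}
  have hE : {X : T × Fin n → 𝒮 | ∃ j, 0 < Q s j ∧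
      η * Q s j < |(empirical (fun i => X (⟨s, hs⟩, i)) j).toReal - Q s j|} = ⋃ j, E j := by
    ext X
    simp [E]
  rw [hE]
  refine (expect_indicator_iUnion_le _ E).trans ?_
  refine (Finset.sum_le_card_nsmul _ _ (2 * ENNReal.ofReal (Real.exp (-b))) fun j _ => ?_).trans
    (by rw [nsmul_eq_mul, Finset.card_univ])
  by_cases hj : 0 < Q s j
  · let e : Fin n ↪ T × Fin n := ⟨fun i => (⟨s, hs⟩, i), fun i i' h => (Prod.ext_iff.1 h).2⟩
    have h1 := expect_indepPMF_relative_deviation (p := fun si : T × Fin n => sampler Q hQ si.1)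
      (q := sampler Q hQ s) (Nat.pos_of_neZero n) e (fun _ => rfl)
      (y := fun x => if x = j then 1 else 0) (fun x => by split_ifs <;> norm_num)
      (fun x => by split_ifs <;> norm_num) hη0 hη1 (m := Q s j)
      (by simp [sampler_toReal])
    refine (expect_indicator_mono _ fun X hX => ?_).trans (h1.trans ?_)
    · have := hX.2
      rw [empirical_apply] at this
      exact this
    · gcongr
      exact hb s j hj
  · have : E j = ∅ := Set.eq_empty_of_forall_notMem fun X hX => hj hX.1
    rw [this, Set.indicator_empty]
    exact (expect_const _ 0).le.trans zero_le

/-- There is a test for estimated rows that an empirical distribution fails with small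
probability, such that the value function is well approximated if all rows pass. -/
theorem exists_row_test [Nonempty 𝒮] {c : 𝒮 → ℝ} (hc : ∀ s, 0 ≤ c s) {α : ℝ}
    (hα : α ∈ Set.Ioo (0 : ℝ) 1) {εrel εabs δ : ℝ} (hrel : εrel ∈ Set.Ioo (0 : ℝ) 1)
    (habs : 0 < εabs) (hδ : 0 < δ) {n : ℕ} [NeZero n]
    (hn : nBstar Q c α εrel εabs δ ≤ (n : ℝ)) :
    ∃ bad : 𝒮 → PMF 𝒮 → Prop, (∀ s, ¬ bad s (sampler Q hQ s)) ∧
      (∀ (T : Finset 𝒮) (s : 𝒮) (hs : s ∈ T),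
        expect (indepPMF fun si : T × Fin n => sampler Q hQ si.1)
          ({X | bad s (empirical fun i => X (⟨s, hs⟩, i))}.indicator 1) ≤
          ENNReal.ofReal (δ / (2 * Fintype.card 𝒮))) ∧
      ∀ R : 𝒮 → PMF 𝒮, (∀ s s', sampler Q hQ s s' = 0 → R s s' = 0) → (∀ s, ¬ bad s (R s)) →
        ∀ s, |valueFn (rowsMatrix R) c α s - valueFn Q c α s| ≤
          εrel / 2 * valueFn Q c α s + εabs / 2 := by
  obtain ⟨hr0, hr1⟩ := hrel
  have hα1 : 0 < 1 - α := sub_pos.2 hα.2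
  have hS : (0 : ℝ) < Fintype.card 𝒮 := Nat.cast_pos.2 Fintype.card_pos
  rw [nBstar] at hn
  -- If the ceiling is not positive (in particular if `c = 0`, as `Real.log 0 = 0`), then `‖c‖ ≤
  -- εabs / 2`, and any two value functions are that close. No row needs testing.
  rcases le_or_gt ⌈Real.log (2 * ‖c‖ / εabs) / (1 - α)⌉ 0 with hN | hN
  · refine ⟨fun _ _ => False, by simp, fun T s hs => ?_, fun R _ _ s => ?_⟩
    · simp only [Set.ofPred_false, Set.indicator_empty]
      exact (expect_const _ 0).le.trans zero_le
    · have hlog : Real.log (2 * ‖c‖ / εabs) ≤ 0 := by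
        have := Int.ceil_le.1 hN
        rw [Int.cast_zero, div_le_iff₀ hα1, zero_mul] at this
        exact this
      have hcn : ‖c‖ ≤ εabs / 2 := by
        have := (Real.log_nonpos_iff (by positivity)).1 hlog
        rw [div_le_one habs] at this
        linarith
      have hR := rowsMatrix_mem_rowStochastic R
      have h1 := mul_valueFn_le hR hQ hc hα zero_le_one le_rfl zero_le_one (N := 0) (s := s)
        (by simp)
      have h2 := mul_valueFn_le hQ hR hc hα zero_le_one le_rfl zero_le_one (N := 0) (s := s)
        (by simp)
      have h3 := mul_nonneg (half_pos hr0).le (valueFn_nonneg hQ hc hα s)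
      rw [abs_le]
      constructor <;> linarith
  · obtain ⟨N, hNe⟩ := Int.eq_ofNat_of_zero_le hN.le
    have hceil := Int.le_ceil (Real.log (2 * ‖c‖ / εabs) / (1 - α))
    rw [hNe] at hN hn hceil
    have hN1 : 1 ≤ N := by exact_mod_cast hN
    have hN1' : (1 : ℝ) ≤ N := by exact_mod_cast hN1
    have hN0 : (0 : ℝ) < N := by linarith
    rw [Int.cast_natCast] at hn hceil
    set L := Real.log (1 + εrel / 2) with hL
    have hL0 : 0 < L := Real.log_pos (by linarith)
    have hL1 : L ≤ εrel / 2 := by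
      have := Real.log_le_sub_one_of_pos (by linarith : 0 < 1 + εrel / 2)
      linarith
    have hη0 : 0 < L / N := div_pos hL0 hN0
    have hη1 : L / N ≤ 1 / 2 := (div_le_self hL0.le hN1').trans (by linarith)
    have hNη : N * (L / N) = L := mul_div_cancel₀ L hN0.ne'
    -- The tolerance `η = L / N` is chosen so that `exp (N η) = 1 + εrel / 2`: relative errors
    -- compounded over `N` steps stay within `εrel / 2`.
    refine ⟨fun s p => ∃ j, 0 < Q s j ∧ L / N * Q s j < |(p j).toReal - Q s j|, ?_, ?_, ?_⟩
    · rintro s ⟨j, hj, h⟩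
      rw [sampler_toReal, sub_self, abs_zero] at h
      exact absurd h (not_lt.2 (mul_pos hη0 hj).le)
    · intro T s hs
      refine (expect_empirical_deviation_le hQ hη0.le hη1
        (b := Real.log (4 * (Fintype.card 𝒮 : ℝ) ^ 2 / δ)) (fun i j hij => ?_) T s hs).trans ?_
      · obtain ⟨hq0, hq1⟩ := minPosEntry_pos_and_le hij
        have h1 : 3 * Real.log (4 * (Fintype.card 𝒮 : ℝ) ^ 2 / δ) * N ^ 2 ≤
            n * (L ^ 2 * minPosEntry Q) := by
          rwa [div_mul_eq_mul_div, div_le_iff₀ (by positivity)] at hn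
        have h2 : (n : ℝ) * (L ^ 2 * minPosEntry Q) ≤ n * (L ^ 2 * Q i j) := by gcongr
        have h3 : (n : ℝ) * Q i j * (L / N) ^ 2 / 3 = n * (L ^ 2 * Q i j) / (3 * N ^ 2) := by
          field_simp
        rw [h3, le_div_iff₀ (by positivity)]
        linarith
      -- A union bound over the `S` entries of the row: `S · 2 · δ / (4 S²) = δ / (2 S)`.
      · rw [Real.exp_neg, Real.exp_log (by positivity), ← ENNReal.ofReal_natCast,
          ← ENNReal.ofReal_ofNat 2, ← ENNReal.ofReal_mul (by norm_num),
          ← ENNReal.ofReal_mul hS.le]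
        refine ENNReal.ofReal_le_ofReal (le_of_eq ?_)
        field_simp
        norm_num
    · intro R hsupp hgood s
      have hc0 : 0 < ‖c‖ := by
        refine (norm_nonneg c).lt_of_ne' fun h => ?_
        rw [h] at hNe
        simp only [mul_zero, zero_div, Real.log_zero, Int.ceil_zero] at hNe
        omega
      refine abs_valueFn_sub_le (rowsMatrix_mem_rowStochastic R) hQ hc hα (N := N) hη0.le
        (by linarith) (by linarith) (by linarith) ?_ ?_ ?_ (fun i j => ?_) s
      · calc (1 + L / N) ^ N ≤ Real.exp (L / N) ^ N :=
              pow_le_pow_left₀ (by linarith) (by linarith [Real.add_one_le_exp (L / N)]) N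
          _ = 1 + εrel / 2 := by
              rw [← Real.exp_nat_mul, hNη, hL, Real.exp_log (by linarith)]
      -- Bernoulli: `(1 - L / N)^N ≥ 1 - L ≥ 1 - εrel / 2`.
      · have := one_add_mul_le_pow (a := -(L / N)) (by linarith) N
        rw [← sub_eq_add_neg] at this
        linarith
      · have h1 : Real.log (2 * ‖c‖ / εabs) ≤ N * (1 - α) := (div_le_iff₀ hα1).1 hceil
        calc α ^ N * ‖c‖ ≤ Real.exp (-(1 - α)) ^ N * ‖c‖ := by
              gcongr
              · exact hα.1.le
              · linarith [Real.add_one_le_exp (-(1 - α))]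
          _ = Real.exp (-(N * (1 - α))) * ‖c‖ := by rw [← Real.exp_nat_mul, mul_neg]
          _ ≤ Real.exp (-Real.log (2 * ‖c‖ / εabs)) * ‖c‖ := by gcongr
          _ = εabs / 2 := by
              rw [Real.exp_neg, Real.exp_log (by positivity)]
              field_simp
      · by_cases hij : 0 < Q i j
        · exact not_lt.1 fun h => hgood i ⟨j, hij, h⟩
        · have h0 : Q i j = 0 :=
            le_antisymm (not_lt.1 hij) (Matrix.nonneg_of_mem_rowStochastic hQ)
          have h1 : R i j = 0 := hsupp i j (by rw [sampler_apply, h0, ENNReal.ofReal_zero])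
          simp [rowsMatrix, h0, h1]

end Sampler

/-! ### The forward phase -/

/-- The forward phase is accurate to within a relative and an absolute error. -/
theorem State.Invariant.expect_forward_le [Nonempty 𝒮] {P : 𝒮 → PMF 𝒮} {c : 𝒮 → ℝ}
    {α : ℝ} {x : State 𝒮} (hx : x.Invariant P c α)
    (hα : α ∈ Set.Ioo (0 : ℝ) 1) {ε : ℝ} (hε : 0 < ε) (hres : ‖x.res‖ ≤ ε) {R : 𝒮 → PMF 𝒮}
    (hR : x.IsCompletion P R) {εrel εabs δ : ℝ} (hrel : εrel ∈ Set.Ioo (0 : ℝ) 1)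
    (habs : 0 < εabs) (hδ : 0 < δ) (hδ1 : δ < 1) {n : ℕ}
    (hn : nFstar (Fintype.card 𝒮) ε εrel εabs δ ≤ (n : ℝ)) :
    expect (indepPMF fun si : 𝒮 × Fin n => discountedLaw R α hα si.1)
      ({Z | ∃ s, εrel / 3 * valueFn (rowsMatrix R) c α s + εabs / 3 <
        |x.val s + 1 / (n : ℝ) * ∑ i, x.res (Z (s, i)) - valueFn (rowsMatrix R) c α s|}.indicator 1)
      ≤ ENNReal.ofReal (δ / 2) := by
  obtain ⟨hr0, hr1⟩ := hrel
  have hS : (1 : ℝ) ≤ Fintype.card 𝒮 := by exact_mod_cast Fintype.card_pos (α := 𝒮)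
  have hlog : 0 < Real.log (4 * Fintype.card 𝒮 / δ) :=
    Real.log_pos ((one_lt_div hδ).2 (by linarith))
  rw [nFstar] at hn
  have hn0 : 0 < n := by
    have : (0 : ℝ) < n := lt_of_lt_of_le (by positivity) hn
    exact_mod_cast this
  let E : 𝒮 → Set (𝒮 × Fin n → 𝒮) := fun s =>
    {Z | εrel / 3 * valueFn (rowsMatrix R) c α s + εabs / 3 <
      |x.val s + 1 / (n : ℝ) * ∑ i, x.res (Z (s, i)) - valueFn (rowsMatrix R) c α s|}
  have hE : {Z : 𝒮 × Fin n → 𝒮 | ∃ s, εrel / 3 * valueFn (rowsMatrix R) c α s + εabs / 3 <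
      |x.val s + 1 / (n : ℝ) * ∑ i, x.res (Z (s, i)) - valueFn (rowsMatrix R) c α s|} =
      ⋃ s, E s := by
    ext Z
    simp [E]
  rw [hE]
  refine (expect_indicator_iUnion_le _ E).trans ?_
  refine (Finset.sum_le_card_nsmul _ _
    (ENNReal.ofReal (2 * (δ / (4 * Fintype.card 𝒮)))) fun s _ => ?_).trans ?_
  · let e : Fin n ↪ 𝒮 × Fin n := ⟨fun i => (s, i), fun i i' h => (Prod.ext_iff.1 h).2⟩
    have hv := hx.valueFn_eq hα hR s
    set v := valueFn (rowsMatrix R) c α s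
    have hm : (v - x.val s) / ε = ∑ b, (discountedLaw R α hα s b).toReal * (x.res b / ε) := by
      rw [hv, add_sub_cancel_left, Finset.sum_div]
      exact Finset.sum_congr rfl fun b _ => mul_div_assoc _ _ _
    -- Dividing by `ε` puts the residuals in the unit interval; their mean becomes `(v - v̂) / ε`.
    have h1 := expect_indepPMF_mixed_deviation
      (p := fun si : 𝒮 × Fin n => discountedLaw R α hα si.1) (q := discountedLaw R α hα s) hn0 e
      (fun _ => rfl) (y := fun b => x.res b / ε) (fun b => div_nonneg (hx.res_nonneg b) hε.le)
      (fun b => (div_le_one hε).2 ((le_abs_self _).trans ((norm_le_pi_norm x.res b).trans hres)))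
      (a := εrel / 3) (b := εabs / 3 / ε) (by linarith) (by linarith) hm
    refine (expect_indicator_mono _ fun Z hZ => ?_).trans (h1.trans ?_)
    · have hZ' : εrel / 3 * v + εabs / 3 <
        |x.val s + 1 / (n : ℝ) * ∑ i, x.res (Z (s, i)) - v| := hZ
      change εrel / 3 * ((v - x.val s) / ε) + εabs / 3 / ε <
        |1 / (n : ℝ) * ∑ i, x.res (Z (s, i)) / ε - (v - x.val s) / ε|
      have h2 : 1 / (n : ℝ) * ∑ i, x.res (Z (s, i)) / ε - (v - x.val s) / ε =
          (x.val s + 1 / (n : ℝ) * ∑ i, x.res (Z (s, i)) - v) / ε := by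
        rw [← Finset.sum_div]
        ring
      rw [h2, abs_div, abs_of_pos hε, ← mul_div_assoc, ← add_div]
      refine div_lt_div_of_pos_right (lt_of_le_of_lt ?_ hZ') hε
      -- As `v̂ ≥ 0`, the Chernoff threshold, relative to `v - v̂`, is no larger than the one
      -- relative to `v`.
      have := mul_nonneg hr0.le (hx.val_nonneg s)
      linarith
    · rw [ENNReal.ofReal_mul (by norm_num), ENNReal.ofReal_ofNat]
      gcongr
      -- This needs only `n ≥ 9 ε log(4S/δ) / (εrel εabs)`; the constant `324` and the square of
      -- `εrel` leave room.
      have h3 : Real.log (4 * Fintype.card 𝒮 / δ) ≤ n * (εrel / 3 * (εabs / 3 / ε)) := by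
        rw [div_le_iff₀ (by positivity)] at hn
        have h4 : (n : ℝ) * (εrel / 3 * (εabs / 3 / ε)) =
            n * (εrel * εabs) / (9 * ε) := by field_simp; norm_num
        rw [h4, le_div_iff₀ (by positivity)]
        have h5 : (n : ℝ) * (εrel ^ 2 * εabs) ≤ n * (εrel * εabs) := by
          gcongr
          nlinarith
        nlinarith [mul_pos hε hlog]
      calc Real.exp (-(n * (εrel / 3 * (εabs / 3 / ε))))
          ≤ Real.exp (-Real.log (4 * Fintype.card 𝒮 / δ)) := by gcongr
        _ = δ / (4 * Fintype.card 𝒮) := by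
            rw [Real.exp_neg, Real.exp_log (by positivity), inv_div]
  · rw [nsmul_eq_mul, Finset.card_univ, ← ENNReal.ofReal_natCast,
      ← ENNReal.ofReal_mul (by positivity)]
    refine ENNReal.ofReal_le_ofReal (le_of_eq ?_)
    field_simp
    norm_num

end EPE

end

/-! ### The main theorem -/

open EPE in
theorem theorem3 {𝒮 : Type*} [Fintype 𝒮] [DecidableEq 𝒮] [Nonempty 𝒮]
    (Q : Matrix 𝒮 𝒮 ℝ) (hQ : Q ∈ Matrix.rowStochastic ℝ 𝒮)
    (c : 𝒮 → ℝ) (hc : ∀ s, 0 ≤ c s)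
    (α : ℝ) (hα : α ∈ Set.Ioo (0 : ℝ) 1)
    (A : 𝒮 → 𝒮 → Bool) (hA : ∀ s s', A s s' = false → Q s s' = 0)
    (ε : ℝ) (hε : 0 < ε)
    (εrel εabs δ : ℝ) (hrel : εrel ∈ Set.Ioo (0 : ℝ) 1) (habs : 0 < εabs) (hδ : 0 < δ)
    (nB nF : ℕ) [NeZero nB]
    (hnF : EPE.nFstar (Fintype.card 𝒮) ε εrel εabs δ ≤ (nF : ℝ))
    (hnB : EPE.nBstar Q c α εrel εabs δ ≤ (nB : ℝ)) :
    (EPE.bidirectionalEPE (EPE.sampler Q hQ) c α hα A ε nB nF).toOuterMeasure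
        {o | ¬ ∃ vBD : 𝒮 → ℝ, o = some vBD ∧
          ∀ s, |vBD s - EPE.valueFn Q c α s| ≤ εrel * EPE.valueFn Q c α s + εabs}
      ≤ ENNReal.ofReal δ := by
  classical
  rw [toOuterMeasure_eq_expect]
  -- For `δ < 1` the logarithm in `n_F^*` is positive, so at least one forward sample is drawn.
  rcases le_or_gt 1 δ with hδ1 | hδ1
  · exact (expect_indicator_le_one _ _).trans (ENNReal.one_le_ofReal.2 hδ1)
  have hS : (0 : ℝ) < Fintype.card 𝒮 := Nat.cast_pos.2 Fintype.card_pos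
  have hA' : ∀ s s', A s s' = false → sampler Q hQ s s' = 0 := fun s s' h => by
    rw [sampler_apply, hA s s' h, ENNReal.ofReal_zero]
  obtain ⟨bad, hP, hbad, hgood⟩ := exists_row_test hQ hc hα hrel habs hδ hnB
  obtain ⟨N, hback, hloop⟩ := exists_backwardEPE_eq_map hc hα hA' hε nB
  rw [bidirectionalEPE, hback, expect_bind, expect_map]
  set b := ENNReal.ofReal (δ / (2 * Fintype.card 𝒮))
  have hpot := (expect_loopIter_le (halt := fun x : State 𝒮 => ‖x.res‖ ≤ ε)
    (body := backwardStep (sampler Q hQ) α A nB) (good := fun _ => True) (Φ := potential bad b)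
    (fun _ _ _ _ _ => trivial) (fun x _ _ => expect_backwardStep_potential_le hbad x) N
    (x := State.init c) trivial).trans (potential_init bad b c).le
  -- Bound on the failure probability given the final backward state: with a bad recorded row the
  -- potential is at least `1`; otherwise only the forward phase can fail, with probability at most
  -- `δ / 2`.
  refine le_trans (expect_mono (g := fun x => ENNReal.ofReal (δ / 2) + potential bad b x)
    fun x hx => ?_) ?_
  · obtain ⟨hxi, hxr⟩ := hloop x hx
    by_cases hrow : ∃ s p, x.row s = some p ∧ bad s p
    · obtain ⟨s, p, hs, hp⟩ := hrow
      exact (expect_indicator_le_one _ _).trans ((one_le_potential hs hp).trans le_add_self)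
    · refine le_trans ?_ le_self_add
      have hR := hxi.isCompletion_mixedRow
      have hv := hgood _ hR.supp fun s => by
        rw [State.mixedRow]
        cases hr : x.row s with
        | none => exact hP s
        | some p => exact fun hp => hrow ⟨s, p, hr, hp⟩
      refine le_trans ?_ (hxi.expect_forward_le hα hε hxr hR hrel habs hδ hδ1 hnF)
      dsimp only
      rw [expect_map]
      refine expect_mono fun Z _ => ?_
      by_cases hZ : ∃ s, εrel / 3 * valueFn (rowsMatrix (x.mixedRow (sampler Q hQ))) c α s +
          εabs / 3 < |x.val s + 1 / (nF : ℝ) * ∑ i, x.res (Z (s, i)) -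
            valueFn (rowsMatrix (x.mixedRow (sampler Q hQ))) c α s|
      · rw [Set.indicator_of_mem (a := Z) (by exact hZ)]
        exact Set.indicator_le_self' (fun _ _ => zero_le) _
      · rw [Set.indicator_of_notMem]
        · exact zero_le
        · refine not_not.2 ⟨_, rfl, fun s => ?_⟩
          have h1 := not_lt.1 fun h => hZ ⟨s, h⟩
          have h2 := hv s
          have h3 := valueFn_nonneg hQ hc hα s
          have h4 := abs_sub_le (x.val s + 1 / (nF : ℝ) * ∑ i, x.res (Z (s, i)))
            (valueFn (rowsMatrix (x.mixedRow (sampler Q hQ))) c α s) (valueFn Q c α s)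
          have h5 : εrel / 3 * valueFn (rowsMatrix (x.mixedRow (sampler Q hQ))) c α s ≤
              εrel / 3 * ((1 + εrel / 2) * valueFn Q c α s + εabs / 2) :=
            mul_le_mul_of_nonneg_left (by linarith [(abs_le.1 h2).2]) (by linarith [hrel.1])
          have h6 : 0 ≤ εrel * (1 - εrel) * valueFn Q c α s :=
            mul_nonneg (mul_nonneg hrel.1.le (sub_nonneg.2 hrel.2.le)) h3
          have h7 : 0 ≤ (1 - εrel) * εabs := mul_nonneg (sub_nonneg.2 hrel.2.le) habs.le
          -- The total is at most `(1/3 + εrel/6 + 1/2) εrel v + (1/3 + εrel/6 + 1/2) εabs`, and the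
          -- bracket is at most `1` since `εrel < 1`.
          linarith
  · rw [expect_add, expect_const]
    refine (add_le_add le_rfl hpot).trans (le_of_eq ?_)
    rw [← ENNReal.ofReal_natCast, ← ENNReal.ofReal_mul hS.le, ← ENNReal.ofReal_add (by positivity)
      (by positivity)]
    congr 1
    field_simp
    norm_num
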